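/- Let $M$ be a finite-dimensional smooth manifold, let $n\ge 2$, and let $\pi$ be a Nambu-Poisson structure of order $n-1$ on $M$: a smooth $n$-vector field such that the bracket $\{f_1,\dots,f_n\}=\pi(df_1,\dots,df_n)$ on $C^\infty(M)$ (which is skew-symmetric, $\mathbb R$-multilinear and satisfies the Leibniz rule) satisfies the fundamental identity $$\{f_1,\dots,f_{n-1},\{g_1,\dots,g_n\}\}=\sum_{i=1}^n\{g_1,\dots,\{f_1,\dots,f_{n-1},g_i\},\dots,g_n\}.$$ Let $\pi^\sharp:\wedge^{n-1}T^*M\to TM$ be the bundle map with $\langle\pi^\sharp(\xi_1\wedge\dots\wedge\xi_{n-1}),\xi_n\rangle=\pi(\xi_1,\dots,\xi_n)$. On $\mathcal T^{n-1}M=TM\oplus\wedge^{n-1}T^*M$ consider the $\wedge^{n-2}T^*M$-valued pairing $(X+\alpha,Y+\beta)_+=i_X\beta+i_Y\alpha$, the higher Dorfman bracket $[\![X+\alpha,Y+\beta]\!]=[X,Y]+L_X\beta-i_Yd\alpha$, the anchor $\rho_\pi(X+\alpha)=X+\pi^\sharp(\alpha)$ and the bracket $$[\![X+\alpha,Y+\beta]\!]_\pi=[X,Y]+[X,\pi^\sharp(\beta)]+[\pi^\sharp(\alpha),Y]-\pi^\sharp(L_X\beta)+\pi^\sharp(i_Yd\alpha)+L_X\beta-i_Yd\alpha+[\alpha,\beta]_\pi,$$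 where $[\alpha,\beta]_\pi=L_{\pi^\sharp(\alpha)}\beta-L_{\pi^\sharp(\beta)}\alpha+d\,i_{\pi^\sharp(\beta)}\alpha$, for smooth vector fields $X,Y$ and smooth $(n-1)$-forms $\alpha,\beta$. Then: (i) $(\mathcal T^{n-1}M,[\![\cdot,\cdot]\!]_\pi,\rho_\pi)$ is a Leibniz algebroid, that is, $[\![\cdot,\cdot]\!]_\pi$ is an $\mathbb R$-bilinear bracket on smooth sections, $\rho_\pi$ is a smooth bundle map, and for all smooth sections $e_1,e_2,e_3$ and $f\in C^\infty(M)$ $$[\![e_1,[\![e_2,e_3]\!]_\pi]\!]_\pi=[\![[\![e_1,e_2]\!]_\pi,e_3]\!]_\pi+[\![e_2,[\![e_1,e_3]\!]_\pi]\!]_\pi,$$ $$[\![e_1,fe_2]\!]_\pi=f[\![e_1,e_2]\!]_\pi+\rho_\pi(e_1)(f)\,e_2,\qquad \rho_\pi([\![e_1,e_2]\!]_\pi)=[\rho_\pi(e_1),\rho_\pi(e_2)].$$ Moreover $\Psi(X+\alpha)=X+\alpha+\pi^\sharp(\alpha)$ is an invertible smooth bundle map of $\mathcal T^{n-1}M$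 (a section $e$ is smooth if and only if $\Psi e$ is), and $\Psi[\![e_1,e_2]\!]_\pi=[\![\Psi e_1,\Psi e_2]\!]$ for all smooth sections $e_1,e_2$. (ii) If $M\neq\emptyset$ and $\dim M\ge n-1$, the bracket $[\![\cdot,\cdot]\!]_\pi$ is not skew-symmetric. In every case $$[\![X+\alpha,X+\alpha]\!]_\pi=d(X,\alpha)_++d(\pi^\sharp(\alpha),\alpha)_+-\pi^\sharp(d(X,\alpha)_+).$$ (iii) For all smooth sections $e_1=X+\alpha$, $e_2=Y+\beta$, $e_3=Z+\gamma$, $$\begin{aligned}L_{\rho_\pi(e_1)}(e_2,e_3)_+={}&\big([\![e_1,e_2]\!]_\pi-([X,\pi^\sharp(\beta)]-\pi^\sharp(L_X\beta)+\pi^\sharp(i_Yd\alpha))+i_{\pi^\sharp(\beta)}d\alpha,\;e_3\big)_+\\&+\big(e_2,\;[\![e_1,e_3]\!]_\pi-([X,\pi^\sharp(\gamma)]-\pi^\sharp(L_X\gamma)+\pi^\sharp(i_Zd\alpha))+i_{\pi^\sharp(\gamma)}d\alpha\big)_+.\end{aligned}$$ -/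

import Mathlib

open scoped Manifold ContDiff

noncomputable section

namespace NambuCourant

/-! ### Multilinear algebra on one vector space -/

section Linear

variable {V : Type*} [AddCommGroup V] [Module ℝ V] [TopologicalSpace V]

/-- The contraction `i_v α = α(v, ·, …, ·)` of a form by a vector. -/
def contract {k : ℕ} (α : V [⋀^Fin (k + 1)]→L[ℝ] ℝ) (v : V) : V [⋀^Fin k]→L[ℝ] ℝ :=
  { α.toAlternatingMap.curryLeft v with
    cont := by
      change Continuous fun w : Fin k → V => α (Fin.cons v w)
      exact α.cont.comp (Continuous.finCons continuous_const continuous_id) }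

theorem contract_apply {k : ℕ} (α : V [⋀^Fin (k + 1)]→L[ℝ] ℝ) (v : V) (w : Fin k → V) :
    contract α v w = α (Fin.cons v w) := rfl

variable [IsTopologicalAddGroup V] [ContinuousSMul ℝ V] [T2Space V] [FiniteDimensional ℝ V]

/-- The `j`-th vector of a (chosen) basis of `V`. -/
def bv (V : Type*) [AddCommGroup V] [Module ℝ V] [FiniteDimensional ℝ V]
    (j : Fin (Module.finrank ℝ V)) : V := Module.finBasis ℝ V j

/-- The `j`-th covector of the dual basis. -/
def bc (V : Type*) [AddCommGroup V] [Module ℝ V] [TopologicalSpace V] [IsTopologicalAddGroup V]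
    [ContinuousSMul ℝ V] [T2Space V] [FiniteDimensional ℝ V]
    (j : Fin (Module.finrank ℝ V)) : V →L[ℝ] ℝ :=
  LinearMap.toContinuousLinearMap ((Module.finBasis ℝ V).coord j)

/-- For an `(m+1)`-vector `P`, the linear map `P^♯ : ∧^m V^* → V` with
`⟨P^♯(ξ₁ ∧ ⋯ ∧ ξ_m), ζ⟩ = P(ξ₁, …, ξ_m, ζ)`.  It is written in a basis `(b_j)` with dual basis
`(b^j)`, through `α = (1/m!) ∑_I α(b_{I₁}, …, b_{I_m}) b^{I₁} ∧ ⋯ ∧ b^{I_m}`; the defining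
property is `sharp_wedge` below. -/
def sharp {m : ℕ} (P : (V →L[ℝ] ℝ) [⋀^Fin (m + 1)]→L[ℝ] ℝ) :
    (V [⋀^Fin m]→L[ℝ] ℝ) →ₗ[ℝ] V where
  toFun α := ((m.factorial : ℝ)⁻¹) • ∑ I : Fin m → Fin (Module.finrank ℝ V),
    α (fun i => bv V (I i)) •
      ∑ j, P (Fin.snoc (α := fun _ => V →L[ℝ] ℝ) (fun i => bc V (I i)) (bc V j)) • bv V j
  map_add' α β := by
    simp only [ContinuousAlternatingMap.add_apply, add_smul, Finset.sum_add_distrib, smul_add]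
  map_smul' c α := by
    simp only [ContinuousAlternatingMap.smul_apply, smul_assoc, RingHom.id_apply,
      Finset.smul_sum (r := c), smul_comm c ((m.factorial : ℝ)⁻¹)]

/-- The defining property of `P^♯`.  A form `α` with `α(v₁, …, v_m) = det (ξ_i(v_j))` is
`ξ₁ ∧ ⋯ ∧ ξ_m`. -/
theorem sharp_wedge {m : ℕ} (P : (V →L[ℝ] ℝ) [⋀^Fin (m + 1)]→L[ℝ] ℝ)
    (ξ : Fin m → (V →L[ℝ] ℝ)) (α : V [⋀^Fin m]→L[ℝ] ℝ)
    (hα : ∀ v, α v = (Matrix.of fun i j => ξ i (v j)).det) (ζ : V →L[ℝ] ℝ) :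
    ζ (sharp P α) = P (Fin.snoc (α := fun _ => V →L[ℝ] ℝ) ξ ζ) := by
  classical
  have exp : ∀ η : V →L[ℝ] ℝ, η = ∑ j, η (bv V j) • bc V j := by
    intro η
    ext v
    have h := congrArg η ((Module.finBasis ℝ V).sum_repr v)
    rw [map_sum] at h
    rw [← h]
    simp [bv, bc, mul_comm]
  let Q : MultilinearMap ℝ (fun _ : Fin m => V →L[ℝ] ℝ) ℝ :=
    (LinearMap.applyₗ ζ).compMultilinearMap (MultilinearMap.curryRight P.toMultilinearMap)
  have hQ : ∀ η : Fin m → (V →L[ℝ] ℝ),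
      Q η = P (Fin.snoc (α := fun _ => V →L[ℝ] ℝ) η ζ) := fun η => rfl
  have inner : ∀ I : Fin m → Fin (Module.finrank ℝ V),
      ζ (∑ j, P (Fin.snoc (α := fun _ => V →L[ℝ] ℝ) (fun i => bc V (I i)) (bc V j)) • bv V j)
        = Q (fun i => bc V (I i)) := by
    intro I
    rw [hQ]
    conv_rhs => rw [exp ζ]
    have := map_sum (MultilinearMap.curryRight P.toMultilinearMap (fun i => bc V (I i)))
      (fun j => ζ (bv V j) • bc V j) Finset.univ
    refine Eq.trans ?_ this.symm
    rw [map_sum]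
    refine Finset.sum_congr rfl fun j _ => ?_
    rw [map_smul, map_smul, smul_eq_mul, smul_eq_mul, mul_comm]
    rfl
  have perm : ∀ σ : Equiv.Perm (Fin m), Q (fun i => ξ (σ i)) = (Equiv.Perm.sign σ : ℤ) • Q ξ := by
    intro σ
    let A : AlternatingMap ℝ (V →L[ℝ] ℝ) ℝ (Fin m) :=
      { Q with
        map_eq_zero_of_eq' := by
          intro v i j hv hij
          change P _ = 0
          refine P.map_eq_zero_of_eq _ (i := i.castSucc) (j := j.castSucc) ?_ ?_
          · simpa using hv
          · simpa using hij }
    exact A.map_perm ξ σ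
  have step : ζ (sharp P α) = ((m.factorial : ℝ)⁻¹) *
      ∑ I : Fin m → Fin (Module.finrank ℝ V), α (fun i => bv V (I i)) * Q (fun i => bc V (I i)) := by
    change ζ (((m.factorial : ℝ)⁻¹) • ∑ I : Fin m → Fin (Module.finrank ℝ V), _) = _
    rw [map_smul, map_sum, smul_eq_mul]
    congr 1
    refine Finset.sum_congr rfl fun I _ => ?_
    rw [map_smul, inner, smul_eq_mul]
  rw [step, ← hQ ξ]
  have key : ∀ σ : Equiv.Perm (Fin m),
      ∑ I : Fin m → Fin (Module.finrank ℝ V), (∏ i, ξ (σ i) (bv V (I i))) * Q (fun i => bc V (I i))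
        = (Equiv.Perm.sign σ : ℤ) • Q ξ := by
    intro σ
    rw [← perm σ]
    conv_rhs => enter [2, i]; rw [exp (ξ (σ i))]
    rw [MultilinearMap.map_sum]
    refine Finset.sum_congr rfl fun I _ => ?_
    rw [MultilinearMap.map_smul_univ, smul_eq_mul]
  have : ∑ I : Fin m → Fin (Module.finrank ℝ V), α (fun i => bv V (I i)) * Q (fun i => bc V (I i))
      = (m.factorial : ℝ) * Q ξ := by
    simp only [hα, Matrix.det_apply, Finset.sum_mul, Matrix.of_apply]
    rw [Finset.sum_comm]
    have : ∀ σ : Equiv.Perm (Fin m), ∑ I : Fin m → Fin (Module.finrank ℝ V),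
        (Equiv.Perm.sign σ • ∏ i, ξ (σ i) (bv V (I i))) * Q (fun i => bc V (I i)) = Q ξ := by
      intro σ
      simp only [smul_mul_assoc]
      rw [← Finset.smul_sum, key σ, Units.smul_def, smul_smul]
      rw [← Units.val_mul, Int.units_mul_self, Units.val_one, one_smul]
    rw [Finset.sum_congr rfl fun σ _ => this σ]
    simp [Fintype.card_perm]
  rw [this, inv_mul_cancel_left₀]
  exact_mod_cast m.factorial_ne_zero

end Linear

/-! ### Vector fields, forms and multivector fields on a smooth manifold -/

section Manifold

variable {E : Type*} [NormedAddCommGroup E] [NormedSpace ℝ E]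
  {M : Type*} [TopologicalSpace M] [ChartedSpace E M]

instance instT2SpaceTangent (x : M) : T2Space (TangentSpace 𝓘(ℝ, E) x) :=
  inferInstanceAs (T2Space E)

instance instFiniteDimensionalTangent [FiniteDimensional ℝ E] (x : M) :
    FiniteDimensional ℝ (TangentSpace 𝓘(ℝ, E) x) :=
  inferInstanceAs (FiniteDimensional ℝ E)

/-- Sections of `TM`, not necessarily smooth. -/
abbrev VField (E M : Type*) [NormedAddCommGroup E] [NormedSpace ℝ E]
    [TopologicalSpace M] [ChartedSpace E M] : Type _ :=
  (x : M) → TangentSpace 𝓘(ℝ, E) x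

/-- Sections of `∧^k T^*M`, not necessarily smooth. -/
abbrev DForm (E M : Type*) [NormedAddCommGroup E] [NormedSpace ℝ E]
    [TopologicalSpace M] [ChartedSpace E M] (k : ℕ) : Type _ :=
  (x : M) → (TangentSpace 𝓘(ℝ, E) x) [⋀^Fin k]→L[ℝ] ℝ

/-- Sections of `∧^k TM`, not necessarily smooth; a `k`-vector is an alternating `k`-linear
function of covectors. -/
abbrev MultiVec (E M : Type*) [NormedAddCommGroup E] [NormedSpace ℝ E]
    [TopologicalSpace M] [ChartedSpace E M] (k : ℕ) : Type _ :=
  (x : M) → (TangentSpace 𝓘(ℝ, E) x →L[ℝ] ℝ) [⋀^Fin k]→L[ℝ] ℝ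

/-- Smoothness of a vector field, as a section of the tangent bundle. -/
def SmoothVField [IsManifold 𝓘(ℝ, E) ∞ M] (X : VField E M) : Prop :=
  ContMDiff 𝓘(ℝ, E) (𝓘(ℝ, E).prod 𝓘(ℝ, E)) ∞
    (fun x => (⟨x, X x⟩ : TangentBundle 𝓘(ℝ, E) M))

/-- The expression of a form in the preferred chart around `x₀`: its pullback along the inverse
of the chart (meaningful on the target of the chart). -/
def DForm.inChart {k : ℕ} (x₀ : M) (α : DForm E M k) (y : E) : E [⋀^Fin k]→L[ℝ] ℝ :=
  (α ((extChartAt 𝓘(ℝ, E) x₀).symm y)).compContinuousLinearMap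
    (mfderiv 𝓘(ℝ, E) 𝓘(ℝ, E) (extChartAt 𝓘(ℝ, E) x₀).symm y)

/-- Smoothness of a form: its expressions in charts are smooth. -/
def SmoothDForm {k : ℕ} (α : DForm E M k) : Prop :=
  ∀ x₀ : M, ContDiffOn ℝ ∞ (DForm.inChart x₀ α) (extChartAt 𝓘(ℝ, E) x₀).target

/-- The expression of a multivector field in the preferred chart around `x₀`: its pushforward
along the chart (meaningful on the target of the chart). -/
def MultiVec.inChart {k : ℕ} (x₀ : M) (P : MultiVec E M k) (y : E) :
    (E →L[ℝ] ℝ) [⋀^Fin k]→L[ℝ] ℝ :=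
  (P ((extChartAt 𝓘(ℝ, E) x₀).symm y)).compContinuousLinearMap
    (ContinuousLinearMap.precomp ℝ
      (mfderiv 𝓘(ℝ, E) 𝓘(ℝ, E) (extChartAt 𝓘(ℝ, E) x₀)
        ((extChartAt 𝓘(ℝ, E) x₀).symm y)))

/-- Smoothness of a multivector field: its expressions in charts are smooth. -/
def SmoothMultiVec {k : ℕ} (P : MultiVec E M k) : Prop :=
  ∀ x₀ : M, ContDiffOn ℝ ∞ (MultiVec.inChart x₀ P) (extChartAt 𝓘(ℝ, E) x₀).target

/-- The differential of a function at a point, as a covector. -/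
def dfun (f : M → ℝ) (x : M) : TangentSpace 𝓘(ℝ, E) x →L[ℝ] ℝ := mvfderiv 𝓘(ℝ, E) f x

/-- The Lie bracket of vector fields. -/
def lie (X Y : VField E M) : VField E M := VectorField.mlieBracket 𝓘(ℝ, E) X Y

/-- The interior product `i_X α`. -/
def interior {k : ℕ} (X : VField E M) (α : DForm E M (k + 1)) : DForm E M k :=
  fun x => contract (α x) (X x)

/-- The exterior derivative: at `x`, the exterior derivative of the expression of the form in the
preferred chart around `x`, pulled back to `M`. -/
def extD {k : ℕ} (α : DForm E M k) : DForm E M (k + 1) := fun x =>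
  (extDeriv (DForm.inChart x α) (extChartAt 𝓘(ℝ, E) x x)).compContinuousLinearMap
    (mfderiv 𝓘(ℝ, E) 𝓘(ℝ, E) (extChartAt 𝓘(ℝ, E) x) x)

/-- The Lie derivative of forms, `L_X = i_X d + d i_X` (and `L_X = i_X d` on functions). -/
def lieD : {k : ℕ} → VField E M → DForm E M k → DForm E M k
  | 0, X, α => interior X (extD α)
  | _ + 1, X, α => interior X (extD α) + extD (interior X α)

/-! ### Nambu-Poisson structures -/

/-- A Nambu-Poisson structure of order `m`: a skew-symmetric `(m+1)`-linear bracket on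
`C^∞(M)` which satisfies the Leibniz rule and the fundamental identity. -/
structure IsNambuBracket {m : ℕ}
    (br : C^∞⟮𝓘(ℝ, E), M; ℝ⟯ [⋀^Fin (m + 1)]→ₗ[ℝ] C^∞⟮𝓘(ℝ, E), M; ℝ⟯) : Prop where
  leibniz : ∀ (f g : C^∞⟮𝓘(ℝ, E), M; ℝ⟯) (h : Fin m → C^∞⟮𝓘(ℝ, E), M; ℝ⟯),
    br (Fin.cons (f * g) h) = f * br (Fin.cons g h) + g * br (Fin.cons f h)
  fundamental : ∀ (f : Fin m → C^∞⟮𝓘(ℝ, E), M; ℝ⟯) (g : Fin (m + 1) → C^∞⟮𝓘(ℝ, E), M; ℝ⟯),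
    br (Fin.snoc (α := fun _ => C^∞⟮𝓘(ℝ, E), M; ℝ⟯) f (br g)) =
      ∑ i, br (Function.update g i
        (br (Fin.snoc (α := fun _ => C^∞⟮𝓘(ℝ, E), M; ℝ⟯) f (g i))))

/-- The `(m+1)`-vector field `π` defines a Nambu-Poisson structure of order `m`, with bracket
`{f₁, …, f_{m+1}} = π(df₁, …, df_{m+1})`. -/
def IsNambuPoisson {m : ℕ} (π : MultiVec E M (m + 1)) : Prop :=
  SmoothMultiVec π ∧
    ∃ br : C^∞⟮𝓘(ℝ, E), M; ℝ⟯ [⋀^Fin (m + 1)]→ₗ[ℝ] C^∞⟮𝓘(ℝ, E), M; ℝ⟯,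
      IsNambuBracket br ∧
      ∀ (f : Fin (m + 1) → C^∞⟮𝓘(ℝ, E), M; ℝ⟯) (x : M), br f x = π x (fun i => dfun (f i) x)

/-! ### Leibniz algebroids -/

/-- A Leibniz algebroid on a family `F` of vector spaces over `M` with `Γ` as its set of smooth
sections: a bracket on `Γ` which makes it a (left) Leibniz algebra over `ℝ`, and a bundle map
`ρ : F → TM`, the anchor, with `[e₁, f e₂] = f [e₁, e₂] + ρ(e₁)(f) e₂`; the anchor respects
brackets. -/
structure IsLeibnizAlgebroid [IsManifold 𝓘(ℝ, E) ∞ M]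
    {F : M → Type*} [∀ x, AddCommGroup (F x)] [∀ x, Module ℝ (F x)]
    (Γ : Set ((x : M) → F x))
    (br : ((x : M) → F x) → ((x : M) → F x) → ((x : M) → F x))
    (ρ : (x : M) → F x →ₗ[ℝ] TangentSpace 𝓘(ℝ, E) x) : Prop where
  anchor_smooth : ∀ e ∈ Γ, SmoothVField (fun x => ρ x (e x))
  bracket_mem : ∀ e₁ ∈ Γ, ∀ e₂ ∈ Γ, br e₁ e₂ ∈ Γ
  add_bracket : ∀ e₁ ∈ Γ, ∀ e₂ ∈ Γ, ∀ e₃ ∈ Γ, br (e₁ + e₂) e₃ = br e₁ e₃ + br e₂ e₃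
  bracket_add : ∀ e₁ ∈ Γ, ∀ e₂ ∈ Γ, ∀ e₃ ∈ Γ, br e₁ (e₂ + e₃) = br e₁ e₂ + br e₁ e₃
  smul_bracket : ∀ c : ℝ, ∀ e₁ ∈ Γ, ∀ e₂ ∈ Γ, br (c • e₁) e₂ = c • br e₁ e₂
  bracket_smul : ∀ c : ℝ, ∀ e₁ ∈ Γ, ∀ e₂ ∈ Γ, br e₁ (c • e₂) = c • br e₁ e₂
  leibniz_identity : ∀ e₁ ∈ Γ, ∀ e₂ ∈ Γ, ∀ e₃ ∈ Γ,
    br e₁ (br e₂ e₃) = br (br e₁ e₂) e₃ + br e₂ (br e₁ e₃)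
  leibniz_rule : ∀ e₁ ∈ Γ, ∀ e₂ ∈ Γ, ∀ f : M → ℝ, ContMDiff 𝓘(ℝ, E) 𝓘(ℝ, ℝ) ∞ f →
    br e₁ (fun x => f x • e₂ x) =
      fun x => f x • br e₁ e₂ x + (dfun f x (ρ x (e₁ x))) • e₂ x
  anchor_bracket : ∀ e₁ ∈ Γ, ∀ e₂ ∈ Γ,
    (fun x => ρ x (br e₁ e₂ x)) = lie (fun x => ρ x (e₁ x)) (fun x => ρ x (e₂ x))

/-! ### The bundle `TM ⊕ ∧^k T^*M` -/

/-- The fibre of `TM ⊕ ∧^k T^*M`. -/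
abbrev Fib (E : Type*) {M : Type*} [NormedAddCommGroup E] [NormedSpace ℝ E]
    [TopologicalSpace M] [ChartedSpace E M] (k : ℕ) (x : M) : Type _ :=
  TangentSpace 𝓘(ℝ, E) x × ((TangentSpace 𝓘(ℝ, E) x) [⋀^Fin k]→L[ℝ] ℝ)

/-- Sections of `TM ⊕ ∧^k T^*M`, not necessarily smooth. -/
abbrev Sec (E M : Type*) [NormedAddCommGroup E] [NormedSpace ℝ E]
    [TopologicalSpace M] [ChartedSpace E M] (k : ℕ) : Type _ :=
  (x : M) → Fib E k x

/-- The vector field part of a section. -/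
def Sec.vec {k : ℕ} (e : Sec E M k) : VField E M := fun x => (e x).1

/-- The form part of a section. -/
def Sec.form {k : ℕ} (e : Sec E M k) : DForm E M k := fun x => (e x).2

/-- The section `X + α`. -/
def Sec.mk {k : ℕ} (X : VField E M) (α : DForm E M k) : Sec E M k := fun x => (X x, α x)

/-- The set of smooth sections of `TM ⊕ ∧^k T^*M`. -/
def smoothSec (E M : Type*) [NormedAddCommGroup E] [NormedSpace ℝ E]
    [TopologicalSpace M] [ChartedSpace E M] [IsManifold 𝓘(ℝ, E) ∞ M] (k : ℕ) :
    Set (Sec E M k) :=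
  {e | SmoothVField e.vec ∧ SmoothDForm e.form}

/-- The pairing `(X + α, Y + β)_+ = i_X β + i_Y α`. -/
def pairing {k : ℕ} (e₁ e₂ : Sec E M (k + 1)) : DForm E M k :=
  interior e₁.vec e₂.form + interior e₂.vec e₁.form

/-- The higher Dorfman bracket `[[X + α, Y + β]] = [X, Y] + L_X β - i_Y dα`. -/
def dorfman {k : ℕ} (e₁ e₂ : Sec E M k) : Sec E M k :=
  Sec.mk (lie e₁.vec e₂.vec) (lieD e₁.vec e₂.form - interior e₂.vec (extD e₁.form))

variable [FiniteDimensional ℝ E]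

/-- `π^♯ α`. -/
def sharpF {m : ℕ} (π : MultiVec E M (m + 1)) (α : DForm E M m) : VField E M :=
  fun x => sharp (π x) (α x)

/-- `[α, β]_π = L_{π^♯ α} β - L_{π^♯ β} α + d i_{π^♯ β} α`. -/
def formBracket {k : ℕ} (π : MultiVec E M (k + 2)) (α β : DForm E M (k + 1)) :
    DForm E M (k + 1) :=
  lieD (sharpF π α) β - lieD (sharpF π β) α + extD (interior (sharpF π β) α)

/-- The twisted bracket
`[[X + α, Y + β]]_π = [X, Y] + [X, π^♯ β] + [π^♯ α, Y] - π^♯(L_X β) + π^♯(i_Y dα)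
  + L_X β - i_Y dα + [α, β]_π`. -/
def twisted {k : ℕ} (π : MultiVec E M (k + 2)) (e₁ e₂ : Sec E M (k + 1)) : Sec E M (k + 1) :=
  Sec.mk
    (lie e₁.vec e₂.vec + lie e₁.vec (sharpF π e₂.form) + lie (sharpF π e₁.form) e₂.vec
      - sharpF π (lieD e₁.vec e₂.form) + sharpF π (interior e₂.vec (extD e₁.form)))
    (lieD e₁.vec e₂.form - interior e₂.vec (extD e₁.form) + formBracket π e₁.form e₂.form)

/-- The anchor `ρ_π(X + α) = X + π^♯ α`. -/
def anchor {k : ℕ} (π : MultiVec E M (k + 2)) (x : M) :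
    Fib E (k + 1) x →ₗ[ℝ] TangentSpace 𝓘(ℝ, E) x :=
  LinearMap.fst ℝ _ _ + sharp (π x) ∘ₗ LinearMap.snd ℝ _ _

/-- The bundle map `Ψ(X + α) = X + α + π^♯ α`. -/
def twist {k : ℕ} (π : MultiVec E M (k + 2)) (x : M) :
    Fib E (k + 1) x →ₗ[ℝ] Fib E (k + 1) x :=
  (anchor π x).prod (LinearMap.snd ℝ _ _)

/-- `Ψ` on sections. -/
def twistF {k : ℕ} (π : MultiVec E M (k + 2)) (e : Sec E M (k + 1)) : Sec E M (k + 1) :=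
  fun x => twist π x (e x)

end Manifold

end NambuCourant

end

noncomputable section

namespace NambuCourant

/-! ### Decomposability of multivectors -/

section Plucker

variable {W ι : Type*} [AddCommGroup W] [Module ℝ W] [Fintype ι] [DecidableEq ι]

/-! The core fact is that `π^♯` carries `[α, β]_π` to the Lie bracket of vector fields
(`IsSharpMorphism`). By `formBracket_eq`, `[α, β]_π` is the form part of the Dorfman bracket of `π^♯
α + α` and `π^♯ β + β`. The morphism property therefore says exactly what is needed for the twisted
bracket to be the Dorfman bracket transported along `Ψ` (`twistF_twisted`). The Dorfman axioms are
consequences of the Cartan calculus (`dorfman_leibniz`), and invertibility of `Ψ` transfers them.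

The morphism property is local and comes from splitting the fundamental identity by the choice of
test functions. Linear functions in a chart give `LinearFundamentalIdentity`, which governs the
derivatives of `π`. Replacing one of them by a product of two linear functions vanishing at the
point removes those derivatives and leaves the algebraic `QuadraticIdentity`. With at least three
slots this forces `π` to be decomposable at each point (`QuadraticIdentity.plucker`); with two slots
skew-symmetry suffices. Both cases give `QuadraticIdentity.exchange`. Extended by linearity from
decomposable forms to all forms, the two identities account for every term of `[π^♯ α, π^♯ β]`
(`lieBracket_sharp`).

Parts (ii) and (iii) do not need the morphism property. The square of a section is computed by
Cartan's formula. Skew-symmetry would force `d i_X α = 0` for all smooth `X` and `α`, which fails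
once `α` may be multiplied by functions. In the pairing formula the correction terms reduce the
bracket to `L_{ρ(e₁)}` on both components, up to contractions of `dα` that cancel by skew-symmetry.
-/

/-- Two multilinear maps which agree on tuples from a spanning set are equal. -/
theorem multilinear_ext_of_span {N : Type*} [AddCommGroup N] [Module ℝ N]
    {f g : MultilinearMap ℝ (fun _ : ι => W) N} {S : Set W} (hS : Submodule.span ℝ S = ⊤)
    (h : ∀ c : ι → W, (∀ i, c i ∈ S) → f c = g c) : f = g := by
  -- Induction on the set `s` of slots whose entries may lie outside `S`; freeing one more slot is
  -- linear in that slot.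
  have key : ∀ (s : Finset ι) (c : ι → W), (∀ i ∉ s, c i ∈ S) → f c = g c := by
    intro s
    induction s using Finset.induction_on with
    | empty => intro c hc; exact h c fun i => hc i (by simp)
    | insert a s ha ih =>
      intro c hc
      have : ∀ w ∈ Submodule.span ℝ S, f (Function.update c a w) = g (Function.update c a w) := by
        intro w hw
        induction hw using Submodule.span_induction with
        | mem x hx =>
          refine ih _ fun i hi => ?_
          by_cases hia : i = a
          · subst hia; simpa using hx
          · rw [Function.update_of_ne hia]
            exact hc i (by simp [hia, hi])
        | zero => simp
        | add x y _ _ hx hy =>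
          rw [MultilinearMap.map_update_add, MultilinearMap.map_update_add, hx, hy]
        | smul r x _ hx => rw [MultilinearMap.map_update_smul, MultilinearMap.map_update_smul, hx]
      have := this (c a) (hS ▸ Submodule.mem_top)
      simpa using this
  ext c
  exact key Finset.univ c (by simp)

/-- The quadratic part of the fundamental identity, for a multivector seen as an alternating
function of covectors. -/
def QuadraticIdentity (P : W [⋀^ι]→ₗ[ℝ] ℝ) (p q : ι) : Prop :=
  ∀ (u : ι → W) (b : W) (g : ι → W),
    ∑ i, P (Function.update u q (g i)) * P (Function.update g i b) +
      ∑ i, P (Function.update (Function.update u p b) q (g i)) * P (Function.update g i (u p)) = 0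

/-- Taking `b` equal to the vector already in slot `p` makes the two sums of the identity coincide,
so twice their common value vanishes. A permutation moves the slots `(p, q)` to `(m, l)` at the cost
of a sign. -/
theorem QuadraticIdentity.sum_eq_zero {P : W [⋀^ι]→ₗ[ℝ] ℝ} {p q : ι} (hpq : p ≠ q)
    (h : QuadraticIdentity P p q) (u g : ι → W) {l m : ι} (hml : m ≠ l) :
    ∑ i, P (Function.update u l (g i)) * P (Function.update g i (u m)) = 0 := by
  obtain ⟨σ, hσp, hσq⟩ : ∃ σ : Equiv.Perm ι, σ p = m ∧ σ q = l := by
    refine ⟨Equiv.swap (Equiv.swap p m q) l * Equiv.swap p m, ?_, by simp⟩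
    have h1 : Equiv.swap p m q ≠ m := fun h => hpq <| by
      simpa using (congrArg (Equiv.swap p m) h).symm
    simp [Equiv.swap_apply_of_ne_of_ne h1.symm hml]
  have key : ∀ x, P (Function.update (u ∘ σ) q x) =
      Equiv.Perm.sign σ • P (Function.update u l x) := by
    intro x
    rw [← P.map_perm]
    congr 1
    rw [← hσq, Function.update_comp_equiv]
    simp
  have := h (u ∘ σ) (u m) g
  have e : Function.update (u ∘ σ) p (u m) = u ∘ σ := by
    rw [← hσp]; exact Function.update_eq_self p (u ∘ σ)
  rw [e, Function.comp_apply, hσp] at this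
  simp only [key, smul_mul_assoc, ← Finset.smul_sum] at this
  rcases Int.units_eq_one_or (Equiv.Perm.sign σ) with hs | hs <;>
    · simp only [hs, one_smul, Units.neg_smul] at this
      linarith

/-- Used to collapse a sum of the quadratic identity to the only slot that `f` does not kill. -/
theorem sum_update_eq {P : W [⋀^ι]→ₗ[ℝ] ℝ} (f : W → ℝ) (c : ι → W) (j : ι) (x w : W)
    (hf : ∀ i, i ≠ j → f (c i) = 0) :
    ∑ i, f (Function.update c j x i) * P (Function.update (Function.update c j x) i w) =
      f x * P (Function.update c j w) := by
  rw [Finset.sum_eq_single j]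
  · simp
  · intro i _ hi
    simp [hi, hf i hi]
  · simp

/-- The Plücker relation: the quadratic part of the fundamental identity forces decomposability
as soon as there are at least three slots. -/
theorem QuadraticIdentity.plucker {P : W [⋀^ι]→ₗ[ℝ] ℝ} {p q r : ι} (hpq : p ≠ q) (hrp : r ≠ p)
    (hrq : r ≠ q) (h : QuadraticIdentity P p q) (a g : ι → W) :
    ∑ i, P (Function.update a q (g i)) * P (Function.update g i (a q)) = P a * P g := by
  by_cases hP : ∀ u, P u = 0
  · simp [hP]
  push Not at hP
  obtain ⟨u, hu⟩ := hP
  -- Up to the factor `P u`, the functionals `v l` are dual to the vectors `u l`. With `K` their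
  -- common kernel, `W` is the span of `u` plus `K`; it remains to see that `P` ignores `K`.
  let v : ι → W →ₗ[ℝ] ℝ := fun l => P.toMultilinearMap.toLinearMap u l
  have hv : ∀ l x, v l x = P (Function.update u l x) := fun _ _ => rfl
  have hvu : ∀ l m, m ≠ l → v l (u m) = 0 := by
    intro l m hml
    rw [hv]
    exact P.map_eq_zero_of_eq _ (i := m) (j := l) (by simp [hml]) hml
  have hvs : ∀ l, v l (u l) = P u := by intro l; simp [hv]
  let K : Set W := {x | ∀ l, v l x = 0}
  let S : Set W := Set.range u ∪ K
  have mixed : ∀ (c : ι → W), (∀ i, c i ∈ S) → ∀ i m, c i ∈ K → ∀ j, c j = u m → P c = 0 := by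
    intro c hc i m hi j hj
    -- Pigeonhole: if every `u l` occurred among the `c j`, all slots would be used up, including
    -- slot `i`, whose entry lies in `K`.
    obtain ⟨l, hl⟩ : ∃ l, ∀ j, c j ≠ u l := by
      by_contra! hcon
      choose f hf using hcon
      have inj : Function.Injective f := by
        intro x y hxy
        by_contra hne
        have h1 : u x = u y := by rw [← hf x, ← hf y, hxy]
        have := hvu y x hne
        rw [h1, hvs] at this
        exact hu this
      obtain ⟨l, rfl⟩ := (Finite.injective_iff_surjective.1 inj) i
      have := hi l
      rw [hf, hvs] at this
      exact hu this
    have hml : m ≠ l := by rintro rfl; exact hl j hj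
    have hz : ∀ i, v l (c i) = 0 := by
      intro i
      rcases hc i with ⟨m', hm'⟩ | hk
      · rw [← hm']
        exact hvu l m' fun e => hl i (by rw [← e, hm'])
      · exact hk l
    -- Put the missing `u l` in place of `u m`: `v l` then sees only slot `j`, and the identity
    -- reads `P u * P c = 0`.
    have := h.sum_eq_zero hpq u (Function.update c j (u l)) hml
    simp only [← hv l] at this
    rw [sum_update_eq (v l) c j (u l) (u m) fun i _ => hz i, hvs, ← hj,
      Function.update_eq_self] at this
    exact (mul_eq_zero.1 this).resolve_left hu
  have pure : ∀ (c : ι → W), (∀ i, c i ∈ K) → P c = 0 := by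
    intro c hc
    -- The first sum collapses to `P u * P c`. In the second, each left factor has `c p ∈ K` in slot
    -- `p` and still has `u r` in slot `r`, so `mixed` kills it; this is where a third slot is
    -- needed.
    have h1 := h u (c p) (Function.update c p (u q))
    simp only [← hv q] at h1
    rw [sum_update_eq (v q) c p (u q) (c p) fun i _ => hc i q, hvs, Function.update_eq_self,
      Finset.sum_eq_zero, add_zero] at h1
    · exact (mul_eq_zero.1 h1).resolve_left hu
    · intro i _
      refine mul_eq_zero_of_left (mixed _ ?_ p r ?_ r ?_) _
      · intro j
        by_cases hjq : j = q
        · subst hjq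
          by_cases hip : i = p
          · subst hip; simp [S]
          · simp [hip, S, hc i]
        · by_cases hjp : j = p
          · subst hjp; simp [hjq, S, hc]
          · simp [hjq, hjp, S]
      · simpa [hpq] using hc p
      · simp [hrq, hrp]
  -- `T ∘ V` is the projection onto the span of `u` along `K`.
  let T : (ι → ℝ) →ₗ[ℝ] W :=
    { toFun := fun x => ∑ l, ((P u)⁻¹ * x l) • u l
      map_add' := fun x y => by simp [mul_add, add_smul, Finset.sum_add_distrib]
      map_smul' := fun c x => by
        simp only [Pi.smul_apply, smul_eq_mul, RingHom.id_apply, Finset.smul_sum, smul_smul]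
        exact Finset.sum_congr rfl fun l _ => by ring_nf }
  let V : W →ₗ[ℝ] (ι → ℝ) := LinearMap.pi v
  have hTu : ∀ m, T (V (u m)) = u m := by
    intro m
    change ∑ l, ((P u)⁻¹ * v l (u m)) • u l = u m
    rw [Finset.sum_eq_single m]
    · rw [hvs, inv_mul_cancel₀ hu, one_smul]
    · intro l _ hl
      rw [hvu l m hl.symm, mul_zero, zero_smul]
    · simp
  have hTK : ∀ x ∈ K, T (V x) = 0 := by
    intro x hx
    change ∑ l, ((P u)⁻¹ * v l x) • u l = 0
    simp [hx _]
  have hspan : Submodule.span ℝ S = ⊤ := by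
    rw [eq_top_iff]
    intro x _
    have : x = T (V x) + (x - T (V x)) := by abel
    rw [this]
    refine Submodule.add_mem _ ?_ (Submodule.subset_span (Or.inr ?_))
    · exact Submodule.sum_mem _ fun l _ => Submodule.smul_mem _ _
        (Submodule.subset_span (Or.inl ⟨l, rfl⟩))
    · intro l
      rw [map_sub, sub_eq_zero]
      change v l x = v l (∑ m, ((P u)⁻¹ * v m x) • u m)
      rw [map_sum, Finset.sum_eq_single l]
      · rw [map_smul, hvs, smul_eq_mul]; field_simp
      · intro m _ hm
        rw [map_smul, hvu l m hm, smul_zero]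
      · simp
  -- Thus `P` is pulled back along `V` from an alternating form of top degree on `ι → ℝ`, that is,
  -- from a multiple of the determinant.
  have hPT : ∀ c, P c = (P.compLinearMap T) (fun i => V (c i)) := by
    have : P.toMultilinearMap = ((P.compLinearMap T).compLinearMap V).toMultilinearMap := by
      refine multilinear_ext_of_span hspan fun c hc => ?_
      change P c = P fun i => T (V (c i))
      by_cases hK : ∃ i, c i ∈ K
      · obtain ⟨i, hi⟩ := hK
        rw [P.map_coord_zero (m := fun i => T (V (c i))) i (hTK _ hi)]
        by_cases hm : ∃ j m, c j = u m
        · obtain ⟨j, m, hj⟩ := hm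
          exact mixed c hc i m hi j hj
        · refine pure c fun j => (hc j).resolve_left ?_
          rintro ⟨m, hm'⟩
          exact hm ⟨j, m, hm'.symm⟩
      · refine congrArg P (funext fun i => ?_)
        rcases hc i with ⟨m, hm⟩ | hk
        · rw [← hm, hTu]
        · exact absurd ⟨i, hk⟩ hK
    intro c
    exact congrFun (congrArg DFunLike.coe this) c
  obtain ⟨κ, hκ⟩ : ∃ κ : ℝ, ∀ c, P c = κ * (Matrix.of fun l i => v l (c i)).det := by
    refine ⟨P.compLinearMap T (Pi.basisFun ℝ ι), fun c => ?_⟩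
    rw [hPT, (P.compLinearMap T).eq_smul_basis_det (Pi.basisFun ℝ ι)]
    simp only [AlternatingMap.smul_apply, smul_eq_mul, Module.Basis.det_self, mul_one]
    congr 1
  have hup : ∀ (c : ι → W) (i : ι) (x : W), P (Function.update c i x) =
      κ * Matrix.cramer (Matrix.of fun l i => v l (c i)) (V x) i := by
    intro c i x
    rw [hκ, Matrix.cramer_apply]
    congr 2
    ext l j
    by_cases hj : j = i
    · subst hj; simp [V]
    · simp [hj]
  set G : Matrix ι ι ℝ := Matrix.of fun l i => v l (g i)
  set A : Matrix ι ι ℝ := Matrix.of fun l i => v l (a i)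
  -- `Λ x` is the determinant of `A` with column `q` replaced by `x`. The Plücker relation is
  -- Cramer's rule for `G`, with right-hand side `V (a q)`, read through `Λ`.
  let Λ : (ι → ℝ) →ₗ[ℝ] ℝ := LinearMap.proj q ∘ₗ Matrix.cramer A
  have hΛ : ∀ x, P (Function.update a q x) = κ * Λ (V x) := fun x => hup a q x
  have cram : ∑ i, Matrix.cramer G (V (a q)) i • V (g i) = G.det • V (a q) := by
    rw [← Matrix.mulVec_cramer]
    ext l
    simp [Matrix.mulVec, dotProduct, G, V, mul_comm]
  have := congrArg Λ cram
  rw [map_sum, map_smul, smul_eq_mul] at this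
  have hPa : P a = κ * Λ (V (a q)) := by rw [← hΛ, Function.update_eq_self]
  rw [hκ g, hPa]
  simp only [hΛ, hup g, map_smul, smul_eq_mul] at this ⊢
  calc _ = κ * κ * ∑ x, Matrix.cramer G (V (a q)) x * Λ (V (g x)) := by
        rw [Finset.mul_sum]; exact Finset.sum_congr rfl fun i _ => by ring
    _ = _ := by rw [this]; ring

/-- The exchange identity used for the Nambu-Poisson morphism property. -/
theorem QuadraticIdentity.exchange {k : ℕ} {P : W [⋀^Fin (k + 2)]→ₗ[ℝ] ℝ}
    (h : QuadraticIdentity P 0 (Fin.last (k + 1))) (ξ η : Fin (k + 1) → W) (θ ζ : W) :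
    ∑ j, P (Fin.snoc (α := fun _ => W) ξ (η j)) *
        P (Fin.snoc (α := fun _ => W) (Function.update η j θ) ζ) +
      ∑ j, P (Fin.snoc (α := fun _ => W) η (ξ j)) *
        P (Fin.snoc (α := fun _ => W) (Function.update ξ j θ) ζ) = 0 := by
  -- A bivector has no third slot; there each sum has one term, and the two cancel by skew-symmetry.
  rcases k with _ | k
  · have e : ∀ (x : Fin 1 → W) (y : W), Fin.snoc (α := fun _ => W) x y = ![x 0, y] := by
      intro x y; ext i; fin_cases i <;> rfl
    have : P ![η 0, ξ 0] = - P ![ξ 0, η 0] := by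
      have := P.map_swap ![ξ 0, η 0] (i := 0) (j := 1) (by decide)
      rw [← this]; congr 1; ext i; fin_cases i <;> rfl
    have sum1 : ∀ f : Fin (0 + 1) → ℝ, ∑ j, f j = f 0 := fun f => by simp
    rw [sum1, sum1, e, e, e, e, this]
    simp
  · have hpq : (0 : Fin (k + 3)) ≠ Fin.last (k + 2) := by simp
    have hrp : (1 : Fin (k + 3)) ≠ 0 := by simp
    have hrq : (1 : Fin (k + 3)) ≠ Fin.last (k + 2) := by simp [Fin.ext_iff]
    -- The Plücker relation for `(ξ, θ)` and `(η, ζ)`, with its last summand moved to the right. The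
    -- result changes sign when `ξ` and `η` are exchanged.
    have key : ∀ ξ η : Fin (k + 2) → W,
        ∑ j, P (Fin.snoc (α := fun _ => W) ξ (η j)) *
          P (Fin.snoc (α := fun _ => W) (Function.update η j θ) ζ) =
        P (Fin.snoc (α := fun _ => W) ξ θ) * P (Fin.snoc (α := fun _ => W) η ζ) -
        P (Fin.snoc (α := fun _ => W) ξ ζ) * P (Fin.snoc (α := fun _ => W) η θ) := by
      intro ξ η
      have := h.plucker hpq hrp hrq (Fin.snoc (α := fun _ => W) ξ θ)
        (Fin.snoc (α := fun _ => W) η ζ)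
      rw [Fin.sum_univ_castSucc] at this
      simp only [Fin.snoc_castSucc, Fin.snoc_last, Fin.update_snoc_last, ← Fin.snoc_update] at this
      linarith
    rw [key, key]; ring

end Plucker

/-! ### Decomposable forms and the sharp map -/

section Wedge

variable {V : Type*} [AddCommGroup V] [Module ℝ V] [TopologicalSpace V]

/-- The decomposable form `ξ₁ ∧ ⋯ ∧ ξ_m`. -/
def wedge {m : ℕ} (ξ : Fin m → (V →L[ℝ] ℝ)) : V [⋀^Fin m]→L[ℝ] ℝ :=
  { Matrix.detRowAlternating.compLinearMap (LinearMap.pi fun i => (ξ i : V →ₗ[ℝ] ℝ)) with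
    cont := by
      change Continuous fun v : Fin m → V => Matrix.det (Matrix.of fun j i => ξ i (v j))
      refine Continuous.matrix_det ?_
      refine continuous_matrix fun i j => ?_
      exact (ξ j).continuous.comp (continuous_apply i) }

theorem wedge_apply {m : ℕ} (ξ : Fin m → (V →L[ℝ] ℝ)) (v : Fin m → V) :
    wedge ξ v = (Matrix.of fun i j => ξ i (v j)).det := by
  rw [← Matrix.det_transpose]; rfl

theorem wedge_comp {V' : Type*} [AddCommGroup V'] [Module ℝ V'] [TopologicalSpace V']
    {m : ℕ} (ξ : Fin m → (V →L[ℝ] ℝ)) (D : V' →L[ℝ] V) :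
    (wedge ξ).compContinuousLinearMap D = wedge fun i => (ξ i).comp D := by
  ext v
  simp [wedge_apply]

variable [IsTopologicalAddGroup V] [ContinuousSMul ℝ V] [T2Space V] [FiniteDimensional ℝ V]

theorem vec_ext {x y : V} (h : ∀ ζ : V →L[ℝ] ℝ, ζ x = ζ y) : x = y :=
  (Module.finBasis ℝ V).ext_elem fun i => h (bc V i)

theorem sum_bc_smul_bv (v : V) : ∑ j, bc V j v • bv V j = v :=
  (Module.finBasis ℝ V).sum_repr v

/-- Expand `α` in the basis and the determinants over permutations. Each of the `m!` permutations
contributes `α v`, its sign being absorbed by the alternation of `α`. -/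
theorem form_eq_sum_wedge {m : ℕ} (α : V [⋀^Fin m]→L[ℝ] ℝ) :
    α = ((m.factorial : ℝ)⁻¹) • ∑ I : Fin m → Fin (Module.finrank ℝ V),
      α (fun i => bv V (I i)) • wedge (fun i => bc V (I i)) := by
  have expand : ∀ w : Fin m → V, ∑ I : Fin m → Fin (Module.finrank ℝ V),
      α (fun i => bv V (I i)) * ∏ i, bc V (I i) (w i) = α w := by
    intro w
    conv_rhs => enter [2, i]; rw [← sum_bc_smul_bv (w i)]
    change _ = α.toMultilinearMap _
    rw [MultilinearMap.map_sum]
    refine Finset.sum_congr rfl fun I _ => ?_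
    rw [MultilinearMap.map_smul_univ, smul_eq_mul, mul_comm]
    rfl
  ext v
  have : (m.factorial : ℝ) * α v = ∑ I : Fin m → Fin (Module.finrank ℝ V),
      α (fun i => bv V (I i)) * wedge (fun i => bc V (I i)) v := by
    have e : ∀ I : Fin m → Fin (Module.finrank ℝ V), wedge (fun i => bc V (I i)) v =
        ∑ σ : Equiv.Perm (Fin m), (Equiv.Perm.sign σ : ℤ) * ∏ i, bc V (I i) (v (σ i)) := by
      intro I
      rw [wedge_apply, ← Matrix.det_transpose, Matrix.det_apply']
      rfl
    simp only [e, Finset.mul_sum]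
    rw [Finset.sum_comm]
    have e2 : ∀ σ : Equiv.Perm (Fin m), ∑ I : Fin m → Fin (Module.finrank ℝ V),
        α (fun i => bv V (I i)) * (((Equiv.Perm.sign σ : ℤ) : ℝ) * ∏ i, bc V (I i) (v (σ i))) =
        α v := by
      intro σ
      calc _ = ((Equiv.Perm.sign σ : ℤ) : ℝ) * α (v ∘ σ) := by
            rw [← expand, Finset.mul_sum]
            exact Finset.sum_congr rfl fun I _ => by simp only [Function.comp_apply]; ring
        _ = α v := by
            have : α (v ∘ σ) = Equiv.Perm.sign σ • α v := α.toAlternatingMap.map_perm v σ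
            rw [this]
            rcases Int.units_eq_one_or (Equiv.Perm.sign σ) with hs | hs <;> simp [hs]
    simp [e2, Fintype.card_perm]
  have hm : (m.factorial : ℝ) ≠ 0 := by exact_mod_cast m.factorial_ne_zero
  simp only [ContinuousAlternatingMap.smul_apply, ContinuousAlternatingMap.sum_apply, smul_eq_mul]
  rw [← this, inv_mul_cancel_left₀ hm]

theorem span_wedge {m : ℕ} :
    Submodule.span ℝ (Set.range (wedge : (Fin m → (V →L[ℝ] ℝ)) → V [⋀^Fin m]→L[ℝ] ℝ)) = ⊤ := by
  rw [eq_top_iff]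
  intro α _
  rw [form_eq_sum_wedge α]
  exact Submodule.smul_mem _ _ (Submodule.sum_mem _ fun I _ =>
    Submodule.smul_mem _ _ (Submodule.subset_span ⟨_, rfl⟩))

/-- Linear maps on forms are determined by their values on decomposable forms. -/
theorem form_linear_ext {m : ℕ} {N : Type*} [AddCommGroup N] [Module ℝ N]
    {f g : (V [⋀^Fin m]→L[ℝ] ℝ) →ₗ[ℝ] N} (h : ∀ ξ, f (wedge ξ) = g (wedge ξ)) : f = g :=
  LinearMap.ext_on_range span_wedge h

theorem apply_sharp_wedge {m : ℕ} (P : (V →L[ℝ] ℝ) [⋀^Fin (m + 1)]→L[ℝ] ℝ)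
    (ξ : Fin m → (V →L[ℝ] ℝ)) (ζ : V →L[ℝ] ℝ) :
    ζ (sharp P (wedge ξ)) = P (Fin.snoc (α := fun _ => V →L[ℝ] ℝ) ξ ζ) :=
  sharp_wedge P ξ _ (wedge_apply ξ) ζ

/-- Naturality, which the formula in a chosen basis does not show: both sides are linear in the form
and are determined by the defining property on decomposable forms. This permits the computation of
`π^♯` in charts. -/
theorem sharp_comp {V' : Type*} [AddCommGroup V'] [Module ℝ V'] [TopologicalSpace V']
    [IsTopologicalAddGroup V'] [ContinuousSMul ℝ V'] [T2Space V'] [FiniteDimensional ℝ V']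
    {m : ℕ} (P : (V →L[ℝ] ℝ) [⋀^Fin (m + 1)]→L[ℝ] ℝ) (α : V [⋀^Fin m]→L[ℝ] ℝ)
    (D : V' →L[ℝ] V) (D' : V →L[ℝ] V') (h : D.comp D' = ContinuousLinearMap.id ℝ V) :
    sharp (P.compContinuousLinearMap (ContinuousLinearMap.precomp ℝ D'))
      (α.compContinuousLinearMap D) = D' (sharp P α) := by
  have : (sharp (P.compContinuousLinearMap (ContinuousLinearMap.precomp ℝ D'))) ∘ₗ
      ContinuousAlternatingMap.compContinuousLinearMapₗ D = D'.toLinearMap ∘ₗ sharp P := by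
    refine form_linear_ext fun ξ => vec_ext fun ζ => ?_
    change ζ (sharp _ ((wedge ξ).compContinuousLinearMap D)) = (ζ.comp D') (sharp P (wedge ξ))
    rw [wedge_comp, apply_sharp_wedge, apply_sharp_wedge,
      ContinuousAlternatingMap.compContinuousLinearMap_apply]
    congr 1
    ext i v
    refine Fin.lastCases ?_ (fun j => ?_) i
    · simp
    · have := congrArg (fun L => (ξ j) (L v)) h
      simpa using this
  exact LinearMap.congr_fun this α

end Wedge

/-! ### Derivations of forms, and the sharp map as a bilinear map -/

section Normed

variable {E : Type*} [NormedAddCommGroup E] [NormedSpace ℝ E]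

/-- The action of an endomorphism on forms: `(der A c)(v) = ∑ i, A (v₁, …, c vᵢ, …, v_m)`. -/
def der {m : ℕ} (A : E [⋀^Fin m]→L[ℝ] ℝ) : (E →L[ℝ] E) →L[ℝ] (E [⋀^Fin m]→L[ℝ] ℝ) :=
  A.fderivCompContinuousLinearMap (ContinuousLinearMap.id ℝ E)

theorem der_apply {m : ℕ} (A : E [⋀^Fin m]→L[ℝ] ℝ) (c : E →L[ℝ] E) (v : Fin m → E) :
    der A c v = ∑ i, A (Function.update v i (c (v i))) := by
  rw [der, ContinuousAlternatingMap.fderivCompContinuousLinearMap_apply]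
  refine Finset.sum_congr rfl fun i _ => congrArg A (funext fun j => ?_)
  by_cases hj : j = i
  · subst hj; simp
  · simp [hj]

theorem der_add_left {m : ℕ} (A B : E [⋀^Fin m]→L[ℝ] ℝ) (c : E →L[ℝ] E) :
    der (A + B) c = der A c + der B c := by
  ext v; simp [der_apply, Finset.sum_add_distrib]

theorem der_smul_left {m : ℕ} (r : ℝ) (A : E [⋀^Fin m]→L[ℝ] ℝ) (c : E →L[ℝ] E) :
    der (r • A) c = r • der A c := by
  ext v; simp [der_apply, Finset.mul_sum]

/-- Gives `der` the same shape as the exterior derivative, so that the two can be compared in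
Cartan's formula. -/
theorem der_eq_alternatize {m : ℕ} (A : E [⋀^Fin (m + 1)]→L[ℝ] ℝ) (c : E →L[ℝ] E) :
    der A c = ContinuousAlternatingMap.alternatizeUncurryFin (A.curryLeft ∘L c) := by
  rw [der, ContinuousAlternatingMap.fderivCompContinuousLinearMap_eq_alternatizeUncurryFin]
  change ContinuousAlternatingMap.alternatizeUncurryFin _ = _
  congr 1

/-- Both sides are the trace of `A.adjugate * N`, the derivative of the determinant at `A` in the
direction `N`. -/
theorem det_sum_updateCol {n : Type*} [Fintype n] [DecidableEq n] (A N : Matrix n n ℝ) :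
    ∑ i, (A.updateCol i (fun l => N l i)).det = ∑ j, (A.updateRow j (N j)).det := by
  simp only [← Matrix.cramer_apply, ← Matrix.cramer_transpose_apply,
    Matrix.cramer_eq_adjugate_mulVec, Matrix.mulVec, dotProduct, ← Matrix.adjugate_transpose,
    Matrix.transpose_apply]
  exact Finset.sum_comm

theorem der_wedge {m : ℕ} (η : Fin m → (E →L[ℝ] ℝ)) (c : E →L[ℝ] E) :
    der (wedge η) c = ∑ j, wedge (Function.update η j ((η j).comp c)) := by
  ext v
  rw [der_apply, ContinuousAlternatingMap.sum_apply]
  simp only [wedge_apply]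
  convert! det_sum_updateCol (Matrix.of fun i j => η i (v j)) (fun i j => η i (c (v j))) using 3
  · ext a b
    simp only [Matrix.of_apply, Matrix.updateCol_apply, Function.update_apply]
    split_ifs with h
    · subst h; rfl
    · rfl
  · ext a b
    simp only [Matrix.of_apply, Matrix.updateRow_apply, Function.update_apply]
    split_ifs with h
    · subst h; rfl
    · rfl

variable [FiniteDimensional ℝ E]

/-- The sharp map as a continuous bilinear map. -/
def sharpL (E : Type*) [NormedAddCommGroup E] [NormedSpace ℝ E] [FiniteDimensional ℝ E] (m : ℕ) :
    ((E →L[ℝ] ℝ) [⋀^Fin (m + 1)]→L[ℝ] ℝ) →L[ℝ] (E [⋀^Fin m]→L[ℝ] ℝ) →L[ℝ] E :=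
  ((m.factorial : ℝ)⁻¹) • ∑ I : Fin m → Fin (Module.finrank ℝ E), ∑ j,
    (ContinuousAlternatingMap.apply ℝ (E →L[ℝ] ℝ) ℝ
      (Fin.snoc (α := fun _ => E →L[ℝ] ℝ) (fun i => bc E (I i)) (bc E j))).smulRight
      ((ContinuousAlternatingMap.apply ℝ E ℝ (fun i => bv E (I i))).smulRight (bv E j))

set_option synthInstance.maxHeartbeats 200000 in
theorem sharpL_apply {m : ℕ} (P : (E →L[ℝ] ℝ) [⋀^Fin (m + 1)]→L[ℝ] ℝ)
    (α : E [⋀^Fin m]→L[ℝ] ℝ) : sharpL E m P α = sharp P α := by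
  simp only [sharpL, sharp, smul_apply, sum_apply,
    ContinuousLinearMap.smulRight_apply, ContinuousAlternatingMap.apply_apply, LinearMap.coe_mk,
    AddHom.coe_mk, Finset.smul_sum]
  simp only [smul_smul]
  refine Finset.sum_congr rfl fun I _ => Finset.sum_congr rfl fun j _ => ?_
  ring_nf

theorem apply_sharp_der_wedge {m : ℕ} (P : (E →L[ℝ] ℝ) [⋀^Fin (m + 1)]→L[ℝ] ℝ)
    (η : Fin m → (E →L[ℝ] ℝ)) (c : E →L[ℝ] E) (ζ : E →L[ℝ] ℝ) :
    ζ (sharp P (der (wedge η) c)) =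
      ∑ j, P (Fin.snoc (α := fun _ => E →L[ℝ] ℝ) (Function.update η j ((η j).comp c)) ζ) := by
  rw [der_wedge, map_sum, map_sum]
  exact Finset.sum_congr rfl fun j _ => apply_sharp_wedge _ _ _

/-- Smoothness of a family of forms can be tested on fixed vectors. -/
theorem contDiffOn_form {m : ℕ} {F : Type*} [NormedAddCommGroup F] [NormedSpace ℝ F] {s : Set F}
    {n : WithTop ℕ∞} {α : F → E [⋀^Fin m]→L[ℝ] ℝ}
    (h : ∀ v, ContDiffOn ℝ n (fun y => α y v) s) : ContDiffOn ℝ n α s := by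
  have : α = fun y => ((m.factorial : ℝ)⁻¹) • ∑ I : Fin m → Fin (Module.finrank ℝ E),
      α y (fun i => bv E (I i)) • wedge (fun i => bc E (I i)) :=
    funext fun y => form_eq_sum_wedge (α y)
  have hs : ContDiffOn ℝ n (fun y => ∑ I : Fin m → Fin (Module.finrank ℝ E),
      α y (fun i => bv E (I i)) • wedge (fun i => bc E (I i))) s :=
    ContDiffOn.sum fun I _ => (h fun i => bv E (I i)).smul contDiffOn_const
  rw [this]
  exact hs.const_smul _

end Normed

/-! ### Cartan calculus on a normed space -/

section Flat

open VectorField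
open ContinuousAlternatingMap (alternatizeUncurryFin alternatizeUncurryFin_apply
  alternatizeUncurryFin_add alternatizeUncurryFinCLM_apply curryLeft curryLeftLI)

variable {E : Type*} [NormedAddCommGroup E] [NormedSpace ℝ E]

theorem hasFDerivAt_clm_comp {F G H : Type*} [NormedAddCommGroup F] [NormedSpace ℝ F]
    [NormedAddCommGroup G] [NormedSpace ℝ G] [NormedAddCommGroup H] [NormedSpace ℝ H]
    (L : G →L[ℝ] H) {f : F → G} {f' : F →L[ℝ] G} {y : F} (h : HasFDerivAt f f' y) :
    HasFDerivAt (fun z => L (f z)) (L ∘L f') y :=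
  L.hasFDerivAt.comp y h

theorem contract_eq_curryLeft {m : ℕ} (A : E [⋀^Fin (m + 1)]→L[ℝ] ℝ) (u : E) :
    contract A u = A.curryLeft u := rfl

/-- Contraction by a fixed vector, as a continuous linear map on forms. -/
def contractL (m : ℕ) (u : E) : (E [⋀^Fin (m + 1)]→L[ℝ] ℝ) →L[ℝ] (E [⋀^Fin m]→L[ℝ] ℝ) :=
  (ContinuousLinearMap.apply ℝ _ u) ∘L
    (curryLeftLI (𝕜 := ℝ) (E := E) (F := ℝ) (n := m)).toContinuousLinearMap

theorem contractL_apply {m : ℕ} (A : E [⋀^Fin (m + 1)]→L[ℝ] ℝ) (u : E) :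
    contractL m u A = contract A u := rfl

theorem contract_alternatize_zero (A' : E →L[ℝ] E [⋀^Fin 0]→L[ℝ] ℝ) (u : E) :
    contract (alternatizeUncurryFin A') u = A' u := by
  ext v
  simp [contract_apply, alternatizeUncurryFin_apply, Subsingleton.elim _ v]

/-- In the summand of index zero `u` is the direction of differentiation, which gives `A' u`. In the
others `u` is the first argument of the form, and the shift of index by one reverses the sign. -/
theorem contract_alternatize {m : ℕ} (A' : E →L[ℝ] E [⋀^Fin (m + 1)]→L[ℝ] ℝ) (u : E) :
    contract (alternatizeUncurryFin A') u =
      A' u - alternatizeUncurryFin (contractL m u ∘L A') := by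
  ext v
  rw [contract_apply, alternatizeUncurryFin_apply, ContinuousAlternatingMap.sub_apply,
    alternatizeUncurryFin_apply,
    Fin.sum_univ_succ, sub_eq_add_neg, ← Finset.sum_neg_distrib]
  congr 1
  · simp
  · refine Finset.sum_congr rfl fun i _ => ?_
    have : i.succ.removeNth (Fin.cons u v : Fin (m + 2) → E) = Fin.cons u (i.removeNth v) := by
      ext j
      refine Fin.cases ?_ (fun j => ?_) j <;> simp [Fin.removeNth]
    simp [this, contractL_apply, contract_apply, pow_succ]

/-- The correction removes the term in which `c` acts on the contracted slot. -/
theorem der_contract {m : ℕ} (A : E [⋀^Fin (m + 1)]→L[ℝ] ℝ) (c : E →L[ℝ] E) (u : E) :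
    der (contract A u) c = contract (der A c) u - contract A (c u) := by
  ext v
  rw [ContinuousAlternatingMap.sub_apply, contract_apply, contract_apply, der_apply, der_apply,
    Fin.sum_univ_succ]
  simp [contract_apply, Fin.cons_update]

/-- The Lie derivative of a form on a normed space. -/
def flatLie {m : ℕ} (X : E → E) (α : E → E [⋀^Fin m]→L[ℝ] ℝ) (y : E) : E [⋀^Fin m]→L[ℝ] ℝ :=
  fderiv ℝ α y (X y) + der (α y) (fderiv ℝ X y)

variable {m : ℕ} {X Y : E → E} {α β : E → E [⋀^Fin (m + 1)]→L[ℝ] ℝ} {y : E}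

theorem hasFDerivAt_contract (hα : DifferentiableAt ℝ α y) (hX : DifferentiableAt ℝ X y) :
    HasFDerivAt (fun y => contract (α y) (X y))
      (contractL m (X y) ∘L fderiv ℝ α y + (α y).curryLeft ∘L fderiv ℝ X y) y := by
  have h1 : HasFDerivAt (fun y => (α y).curryLeft)
      ((curryLeftLI (𝕜 := ℝ) (E := E) (F := ℝ) (n := m)).toContinuousLinearMap ∘L fderiv ℝ α y) y :=
    hasFDerivAt_clm_comp (G := E [⋀^Fin (m + 1)]→L[ℝ] ℝ) (H := E →L[ℝ] E [⋀^Fin m]→L[ℝ] ℝ)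
      (curryLeftLI (𝕜 := ℝ) (E := E) (F := ℝ) (n := m)).toContinuousLinearMap hα.hasFDerivAt
  convert! h1.clm_apply hX.hasFDerivAt using 1
  exact add_comm (contractL m (X y) ∘L fderiv ℝ α y) _

theorem cartan_zero {α : E → E [⋀^Fin 0]→L[ℝ] ℝ} :
    contract (extDeriv α y) (X y) = flatLie X α y := by
  rw [extDeriv, contract_alternatize_zero, flatLie]
  ext v
  simp [der_apply]

/-- Differentiating the contraction produces a term in the derivative of `α`, cancelled by the
alternation from `contract_alternatize`, and a term in the derivative of `X`, which is `der`. -/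
theorem cartan (hα : DifferentiableAt ℝ α y) (hX : DifferentiableAt ℝ X y) :
    contract (extDeriv α y) (X y) + extDeriv (fun y => contract (α y) (X y)) y =
      flatLie X α y := by
  rw [extDeriv, extDeriv, contract_alternatize, (hasFDerivAt_contract hα hX).fderiv,
    alternatizeUncurryFin_add, flatLie, der_eq_alternatize]
  abel

/-- The rule `[L_X, i_Y] = i_{[X, Y]}`: differentiating `Y` gives one half of the Lie bracket, and
the correction in `der_contract` gives the other. -/
theorem flatLie_contract (hα : DifferentiableAt ℝ α y) (hY : DifferentiableAt ℝ Y y) :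
    flatLie X (fun y => contract (α y) (Y y)) y =
      contract (flatLie X α y) (Y y) + contract (α y) (lieBracket ℝ X Y y) := by
  have h : ∀ A B : E [⋀^Fin (m + 1)]→L[ℝ] ℝ, contract (A + B) (Y y) =
      contract A (Y y) + contract B (Y y) := fun A B => rfl
  rw [flatLie, flatLie, (hasFDerivAt_contract hα hY).fderiv, der_contract, h, lieBracket]
  simp only [contract_eq_curryLeft, map_sub]
  change curryLeft (fderiv ℝ α y (X y)) (Y y) + (α y).curryLeft (fderiv ℝ Y y (X y)) + _ = _
  abel

theorem flatLie_add {m : ℕ} {α β : E → E [⋀^Fin m]→L[ℝ] ℝ} (hα : DifferentiableAt ℝ α y)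
    (hβ : DifferentiableAt ℝ β y) :
    flatLie X (fun y => α y + β y) y = flatLie X α y + flatLie X β y := by
  simp only [flatLie, fderiv_fun_add hα hβ, der_add_left, _root_.add_apply]
  abel

theorem flatLie_smul {m : ℕ} {f : E → ℝ} {α : E → E [⋀^Fin m]→L[ℝ] ℝ}
    (hf : DifferentiableAt ℝ f y) (hα : DifferentiableAt ℝ α y) :
    flatLie X (fun y => f y • α y) y = f y • flatLie X α y + (fderiv ℝ f y (X y)) • α y := by
  simp only [flatLie, fderiv_fun_smul hf hα, der_smul_left]
  simp only [_root_.add_apply, _root_.smul_apply, ContinuousLinearMap.smulRight_apply,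
    smul_add]
  abel

theorem smulRight_add_right (θ : E →L[ℝ] ℝ) (a b : E) :
    θ.smulRight (a + b) = θ.smulRight a + θ.smulRight b := by
  ext x; simp

theorem smulRight_smul_right (θ : E →L[ℝ] ℝ) (r : ℝ) (a : E) :
    θ.smulRight (r • a) = r • θ.smulRight a := by
  ext x; simp [smul_comm r]

/-! ### The morphism property of a Nambu-Poisson structure on a normed space -/

variable [FiniteDimensional ℝ E] {k : ℕ}

/-- Both terms are bilinear in `(A, B)`. On decomposable forms a covector composed with `θ.smulRight
v` is a multiple of `θ`, and the claim becomes `QuadraticIdentity.exchange`. -/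
theorem sharp_exchange {P : (E →L[ℝ] ℝ) [⋀^Fin (k + 2)]→L[ℝ] ℝ}
    (hP : QuadraticIdentity P.toAlternatingMap 0 (Fin.last (k + 1)))
    (A B : E [⋀^Fin (k + 1)]→L[ℝ] ℝ) (θ : E →L[ℝ] ℝ) :
    sharp P (der B (θ.smulRight (sharp P A))) + sharp P (der A (θ.smulRight (sharp P B))) = 0 := by
  let S : (E [⋀^Fin (k + 1)]→L[ℝ] ℝ) →ₗ[ℝ] (E [⋀^Fin (k + 1)]→L[ℝ] ℝ) →ₗ[ℝ] E :=
    LinearMap.mk₂ ℝ (fun A B => sharp P (der B (θ.smulRight (sharp P A))))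
      (fun A A' B => by
        rw [map_add, smulRight_add_right, map_add, map_add])
      (fun r A B => by
        rw [map_smul, smulRight_smul_right, map_smul, map_smul])
      (fun A B B' => by rw [der_add_left, map_add])
      (fun r A B => by rw [der_smul_left, map_smul])
  suffices S + S.flip = 0 from LinearMap.congr_fun (LinearMap.congr_fun this A) B
  refine form_linear_ext fun ξ => form_linear_ext fun η => vec_ext fun ζ => ?_
  change ζ (sharp P (der (wedge η) (θ.smulRight (sharp P (wedge ξ)))) +
    sharp P (der (wedge ξ) (θ.smulRight (sharp P (wedge η))))) = ζ 0
  rw [map_add, _root_.map_zero, apply_sharp_der_wedge, apply_sharp_der_wedge, ← hP.exchange ξ η θ ζ]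
  have h : ∀ (a b : Fin (k + 1) → (E →L[ℝ] ℝ)) (j : Fin (k + 1)),
      P (Fin.snoc (α := fun _ => E →L[ℝ] ℝ)
        (Function.update a j ((a j).comp (θ.smulRight (sharp P (wedge b))))) ζ) =
      P (Fin.snoc (α := fun _ => E →L[ℝ] ℝ) b (a j)) *
        P (Fin.snoc (α := fun _ => E →L[ℝ] ℝ) (Function.update a j θ) ζ) := by
    intro a b j
    have : (a j).comp (θ.smulRight (sharp P (wedge b))) =
        P (Fin.snoc (α := fun _ => E →L[ℝ] ℝ) b (a j)) • θ := by
      ext x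
      simp [apply_sharp_wedge, mul_comm]
    rw [this, Fin.snoc_update, Fin.snoc_update, P.map_update_smul, smul_eq_mul]
  simp only [h]
  rfl

/-- Linear in `A'`, and in finite dimension `A'` is a sum of rank-one maps `θ.smulRight C`; for
these it is `sharp_exchange`. -/
theorem sharp_exchange_alternatize {P : (E →L[ℝ] ℝ) [⋀^Fin (k + 2)]→L[ℝ] ℝ}
    (hP : QuadraticIdentity P.toAlternatingMap 0 (Fin.last (k + 1)))
    (A' : E →L[ℝ] E [⋀^Fin (k + 1)]→L[ℝ] ℝ) (B : E [⋀^Fin (k + 1)]→L[ℝ] ℝ) :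
    sharp P (der B (sharpL E (k + 1) P ∘L A')) +
      sharp P (alternatizeUncurryFin (contractL k (sharp P B) ∘L A')) = 0 := by
  have key : ∀ (θ : E →L[ℝ] ℝ) (C : E [⋀^Fin (k + 1)]→L[ℝ] ℝ),
      sharp P (der B (sharpL E (k + 1) P ∘L θ.smulRight C)) +
      sharp P (alternatizeUncurryFin (contractL k (sharp P B) ∘L θ.smulRight C)) = 0 := by
    intro θ C
    have e1 : sharpL E (k + 1) P ∘L θ.smulRight C = θ.smulRight (sharp P C) := by
      ext x
      simp [sharpL_apply]
    have e2 : contractL k (sharp P B) ∘L θ.smulRight C =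
        C.curryLeft ∘L θ.smulRight (sharp P B) := by
      ext x v
      simp [contractL_apply, contract_eq_curryLeft]
    rw [← sharp_exchange hP C B θ, der_eq_alternatize C, e1, e2]
  have hA : A' = ∑ j, (bc E j).smulRight (A' (bv E j)) := by
    refine ContinuousLinearMap.ext fun x => ?_
    conv_lhs => rw [← sum_bc_smul_bv x, _root_.map_sum A']
    simp
  rw [hA]
  simp only [ContinuousLinearMap.comp_finsetSum, _root_.map_sum, ← alternatizeUncurryFinCLM_apply]
  rw [← Finset.sum_add_distrib]
  exact Finset.sum_eq_zero fun j _ => key _ _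

/-- The fundamental identity on functions with constant differentials, at the point `y`. -/
def LinearFundamentalIdentity (P : E → (E →L[ℝ] ℝ) [⋀^Fin (k + 2)]→L[ℝ] ℝ) (y : E) : Prop :=
  ∀ (ξ : Fin (k + 1) → (E →L[ℝ] ℝ)) (g : Fin (k + 2) → (E →L[ℝ] ℝ)),
    P y (Fin.snoc (α := fun _ => E →L[ℝ] ℝ) ξ (fderiv ℝ (fun z => P z g) y)) =
      ∑ i, P y (Function.update g i
        (fderiv ℝ (fun z => P z (Fin.snoc (α := fun _ => E →L[ℝ] ℝ) ξ (g i))) y))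

/-- The part of the morphism property that contains the derivative of `P`. For decomposable `A`, `B`
built from `ξ`, `η`, pairing with `ζ` gives the linear fundamental identity with `g = (η, ζ)`; its
last summand is the second term on the left. -/
theorem LinearFundamentalIdentity.sharp_deriv {P : E → (E →L[ℝ] ℝ) [⋀^Fin (k + 2)]→L[ℝ] ℝ}
    (h : LinearFundamentalIdentity P y) (hP : DifferentiableAt ℝ P y)
    (A B : E [⋀^Fin (k + 1)]→L[ℝ] ℝ) :
    sharp (fderiv ℝ P y (sharp (P y) A)) B - sharp (fderiv ℝ P y (sharp (P y) B)) A =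
      sharp (P y) (der B ((sharpL E (k + 1)).flip A ∘L fderiv ℝ P y)) := by
  let S : (E [⋀^Fin (k + 1)]→L[ℝ] ℝ) →ₗ[ℝ] (E [⋀^Fin (k + 1)]→L[ℝ] ℝ) →ₗ[ℝ] E :=
    LinearMap.mk₂ ℝ (fun A B => sharpL E (k + 1) (fderiv ℝ P y (sharp (P y) A)) B)
      (fun A A' B => by simp only [map_add, _root_.add_apply])
      (fun r A B => by simp only [map_smul, _root_.smul_apply])
      (fun A B B' => by rw [map_add])
      (fun r A B => by rw [map_smul])
  let T : (E [⋀^Fin (k + 1)]→L[ℝ] ℝ) →ₗ[ℝ] (E [⋀^Fin (k + 1)]→L[ℝ] ℝ) →ₗ[ℝ] E :=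
    LinearMap.mk₂ ℝ (fun A B => sharp (P y) (der B ((sharpL E (k + 1)).flip A ∘L fderiv ℝ P y)))
      (fun A A' B => by rw [map_add, ContinuousLinearMap.add_comp, map_add, map_add])
      (fun r A B => by rw [map_smul, ContinuousLinearMap.smul_comp, map_smul, map_smul])
      (fun A B B' => by rw [der_add_left, map_add])
      (fun r A B => by rw [der_smul_left, map_smul])
  suffices S - S.flip = T by
    have := LinearMap.congr_fun (LinearMap.congr_fun this A) B
    simpa only [S, T, LinearMap.sub_apply, LinearMap.flip_apply, LinearMap.mk₂_apply,
      sharpL_apply] using this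
  have hd : ∀ g w, fderiv ℝ (fun z => P z g) y w = fderiv ℝ P y w g := by
    intro g w
    have : HasFDerivAt (fun z => P z g)
        ((ContinuousAlternatingMap.apply ℝ (E →L[ℝ] ℝ) ℝ g) ∘L fderiv ℝ P y) y :=
      hasFDerivAt_clm_comp (G := (E →L[ℝ] ℝ) [⋀^Fin (k + 2)]→L[ℝ] ℝ) (H := ℝ)
        (ContinuousAlternatingMap.apply ℝ (E →L[ℝ] ℝ) ℝ g) hP.hasFDerivAt
    rw [this.fderiv]; rfl
  refine form_linear_ext fun ξ => form_linear_ext fun η => vec_ext fun ζ => ?_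
  change ζ (sharpL E (k + 1) (fderiv ℝ P y (sharp (P y) (wedge ξ))) (wedge η) -
    sharpL E (k + 1) (fderiv ℝ P y (sharp (P y) (wedge η))) (wedge ξ)) =
    ζ (sharp (P y) (der (wedge η) ((sharpL E (k + 1)).flip (wedge ξ) ∘L fderiv ℝ P y)))
  rw [map_sub, sharpL_apply, sharpL_apply, apply_sharp_wedge, apply_sharp_wedge,
    apply_sharp_der_wedge]
  have e : ∀ j, (η j).comp ((sharpL E (k + 1)).flip (wedge ξ) ∘L fderiv ℝ P y) =
      fderiv ℝ (fun z => P z (Fin.snoc (α := fun _ => E →L[ℝ] ℝ) ξ (η j))) y := by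
    intro j
    ext w
    rw [hd, ← apply_sharp_wedge, ← sharpL_apply]
    rfl
  have := h ξ (Fin.snoc (α := fun _ => E →L[ℝ] ℝ) η ζ)
  rw [Fin.sum_univ_castSucc, ← apply_sharp_wedge, hd] at this
  simp only [Fin.snoc_castSucc, Fin.snoc_last, Fin.update_snoc_last, ← Fin.snoc_update] at this
  rw [← apply_sharp_wedge (P y) η, hd] at this
  simp only [e]
  linarith

theorem fderiv_sharp {m : ℕ} {P : E → (E →L[ℝ] ℝ) [⋀^Fin (m + 1)]→L[ℝ] ℝ}
    {γ : E → E [⋀^Fin m]→L[ℝ] ℝ} (hP : DifferentiableAt ℝ P y) (hγ : DifferentiableAt ℝ γ y) :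
    fderiv ℝ (fun z => sharp (P z) (γ z)) y =
      sharpL E m (P y) ∘L fderiv ℝ γ y + (sharpL E m).flip (γ y) ∘L fderiv ℝ P y := by
  have h1 : HasFDerivAt (fun z => sharpL E m (P z)) (sharpL E m ∘L fderiv ℝ P y) y :=
    hasFDerivAt_clm_comp (G := (E →L[ℝ] ℝ) [⋀^Fin (m + 1)]→L[ℝ] ℝ)
      (H := (E [⋀^Fin m]→L[ℝ] ℝ) →L[ℝ] E) (sharpL E m) hP.hasFDerivAt
  have h2 := h1.clm_apply hγ.hasFDerivAt
  simp only [sharpL_apply] at h2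
  rw [h2.fderiv]
  rfl

/-- After expansion, the derivatives of `α` along `π^♯ β` and of `β` along `π^♯ α` agree on both
sides. The derivatives of `P` match by `sharp_deriv`, and the remaining derivatives of `α` cancel by
`sharp_exchange_alternatize`. -/
theorem lieBracket_sharp {P : E → (E →L[ℝ] ℝ) [⋀^Fin (k + 2)]→L[ℝ] ℝ}
    {α β : E → E [⋀^Fin (k + 1)]→L[ℝ] ℝ} (hP : DifferentiableAt ℝ P y)
    (hα : DifferentiableAt ℝ α y) (hβ : DifferentiableAt ℝ β y)
    (h : LinearFundamentalIdentity P y)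
    (hq : QuadraticIdentity (P y).toAlternatingMap 0 (Fin.last (k + 1))) :
    lieBracket ℝ (fun z => sharp (P z) (α z)) (fun z => sharp (P z) (β z)) y =
      sharp (P y) (flatLie (fun z => sharp (P z) (α z)) β y -
        contract (extDeriv α y) (sharp (P y) (β y))) := by
  have h1 := h.sharp_deriv hP (α y) (β y)
  have h2 := sharp_exchange_alternatize hq (fderiv ℝ α y) (β y)
  rw [lieBracket, flatLie, extDeriv, contract_alternatize, fderiv_sharp hP hα, fderiv_sharp hP hβ]
  simp only [map_add, map_sub, _root_.add_apply, ContinuousLinearMap.comp_apply,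
    ContinuousLinearMap.flip_apply, sharpL_apply]
  rw [← h1]
  rw [add_eq_zero_iff_eq_neg] at h2
  rw [h2]
  abel

end Flat

/-! ### Local expressions in charts -/

section Charts

open Set VectorField

variable {E : Type*} [NormedAddCommGroup E] [NormedSpace ℝ E]
  {M : Type*} [TopologicalSpace M] [ChartedSpace E M]

/-- The derivative of the inverse of the preferred chart around `x₀`. -/
def chartD (x₀ : M) (y : E) : E →L[ℝ] TangentSpace 𝓘(ℝ, E) ((extChartAt 𝓘(ℝ, E) x₀).symm y) :=
  mfderiv 𝓘(ℝ, E) 𝓘(ℝ, E) (extChartAt 𝓘(ℝ, E) x₀).symm y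

/-- The derivative of the preferred chart around `x₀`, at the point with coordinates `y`. -/
def chartD' (x₀ : M) (y : E) : TangentSpace 𝓘(ℝ, E) ((extChartAt 𝓘(ℝ, E) x₀).symm y) →L[ℝ] E :=
  mfderiv 𝓘(ℝ, E) 𝓘(ℝ, E) (extChartAt 𝓘(ℝ, E) x₀) ((extChartAt 𝓘(ℝ, E) x₀).symm y)

/-- The expression of a vector field in the preferred chart around `x₀`. -/
def VField.inChart (x₀ : M) (X : VField E M) (y : E) : E :=
  chartD' x₀ y (X ((extChartAt 𝓘(ℝ, E) x₀).symm y))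

theorem DForm.inChart_apply {k : ℕ} (x₀ : M) (α : DForm E M k) (y : E) (v : Fin k → E) :
    DForm.inChart x₀ α y v = α ((extChartAt 𝓘(ℝ, E) x₀).symm y) fun i => chartD x₀ y (v i) := rfl

theorem MultiVec.inChart_apply {k : ℕ} (x₀ : M) (P : MultiVec E M k) (y : E)
    (ξ : Fin k → (E →L[ℝ] ℝ)) :
    MultiVec.inChart x₀ P y ξ =
      P ((extChartAt 𝓘(ℝ, E) x₀).symm y) fun i => (ξ i).comp (chartD' x₀ y) := rfl

theorem VField.inChart_add (x₀ : M) (X Y : VField E M) (y : E) :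
    VField.inChart x₀ (X + Y) y = VField.inChart x₀ X y + VField.inChart x₀ Y y :=
  map_add (chartD' x₀ y) _ _

theorem DForm.inChart_add {k : ℕ} (x₀ : M) (α β : DForm E M k) (y : E) :
    DForm.inChart x₀ (α + β) y = DForm.inChart x₀ α y + DForm.inChart x₀ β y := rfl

theorem VField.inChart_smul (x₀ : M) (f : M → ℝ) (X : VField E M) (y : E) :
    VField.inChart x₀ (fun x => f x • X x) y =
      f ((extChartAt 𝓘(ℝ, E) x₀).symm y) • VField.inChart x₀ X y :=
  map_smul (chartD' x₀ y) _ _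

theorem extChartAt_target_mem_nhds' {x₀ : M} {y : E} (hy : y ∈ (extChartAt 𝓘(ℝ, E) x₀).target) :
    (extChartAt 𝓘(ℝ, E) x₀).target ∈ nhds y :=
  (isOpen_extChartAt_target x₀).mem_nhds hy

theorem SmoothDForm.contDiffAt {k : ℕ} {α : DForm E M k} (hα : SmoothDForm α) {x₀ : M} {y : E}
    (hy : y ∈ (extChartAt 𝓘(ℝ, E) x₀).target) : ContDiffAt ℝ ∞ (DForm.inChart x₀ α) y :=
  (hα x₀).contDiffAt (extChartAt_target_mem_nhds' hy)

theorem SmoothMultiVec.contDiffAt {k : ℕ} {α : MultiVec E M k} (hα : SmoothMultiVec α) {x₀ : M}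
    {y : E} (hy : y ∈ (extChartAt 𝓘(ℝ, E) x₀).target) :
    ContDiffAt ℝ ∞ (MultiVec.inChart x₀ α) y :=
  (hα x₀).contDiffAt (extChartAt_target_mem_nhds' hy)

theorem SmoothDForm.differentiableAt {k : ℕ} {α : DForm E M k} (hα : SmoothDForm α) {x₀ : M}
    {y : E} (hy : y ∈ (extChartAt 𝓘(ℝ, E) x₀).target) :
    DifferentiableAt ℝ (DForm.inChart x₀ α) y :=
  (hα.contDiffAt hy).differentiableAt (by simp)

variable [IsManifold 𝓘(ℝ, E) ∞ M]

theorem chartD_comp_chartD' {x₀ : M} {y : E} (hy : y ∈ (extChartAt 𝓘(ℝ, E) x₀).target) :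
    (chartD x₀ y).comp (chartD' x₀ y) = ContinuousLinearMap.id ℝ _ := by
  have := mfderivWithin_extChartAt_symm_comp_mfderiv_extChartAt (I := 𝓘(ℝ, E)) hy
  rwa [modelWithCornersSelf_coe, range_id, mfderivWithin_univ] at this

theorem chartD'_comp_chartD {x₀ : M} {y : E} (hy : y ∈ (extChartAt 𝓘(ℝ, E) x₀).target) :
    (chartD' x₀ y).comp (chartD x₀ y) = ContinuousLinearMap.id ℝ E := by
  have := mfderiv_extChartAt_comp_mfderivWithin_extChartAt_symm (I := 𝓘(ℝ, E)) hy
  rwa [modelWithCornersSelf_coe, range_id, mfderivWithin_univ] at this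

theorem chartD_chartD' {x₀ : M} {y : E} (hy : y ∈ (extChartAt 𝓘(ℝ, E) x₀).target)
    (v : TangentSpace 𝓘(ℝ, E) ((extChartAt 𝓘(ℝ, E) x₀).symm y)) :
    chartD x₀ y (chartD' x₀ y v) = v :=
  congrArg (fun L => L v) (chartD_comp_chartD' hy)

/-- A form on `M`, seen as a function with values in the forms on the model space. -/
def DForm.raw {k : ℕ} (α : DForm E M k) : M → E [⋀^Fin k]→L[ℝ] ℝ := α

/-- A vector field on `M`, seen as a function with values in the model space. -/
def VField.raw (X : VField E M) : M → E := X

/-- The tangent space at `x` is identified with `E` through the preferred chart at `x`, so the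
derivative of that chart at its centre is the identity. Sections can hence be compared through their
chart expressions at the centres alone. -/
theorem DForm.inChart_self {k : ℕ} (α : DForm E M k) (x : M) :
    DForm.inChart x α (extChartAt 𝓘(ℝ, E) x x) = DForm.raw α x := by
  have h : ∀ v, chartD x (extChartAt 𝓘(ℝ, E) x x) v = v := by
    intro v
    have := mfderivWithin_range_extChartAt_symm (I := 𝓘(ℝ, E)) (x := x)
    rw [modelWithCornersSelf_coe, range_id, mfderivWithin_univ] at this
    exact congrArg (fun L => L v) this
  ext v
  rw [DForm.inChart_apply]
  simp only [h]
  -- `raw` forgets the dependence of the fibre on the point, so that the base point can be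
  -- rewritten.
  change DForm.raw α _ v = _
  rw [extChartAt_to_inv]

theorem VField.inChart_self (X : VField E M) (x : M) :
    VField.inChart x X (extChartAt 𝓘(ℝ, E) x x) = VField.raw X x := by
  have h : ∀ (z : M) (_ : z = x) (w : E), mfderiv 𝓘(ℝ, E) 𝓘(ℝ, E) (extChartAt 𝓘(ℝ, E) x) z w = w := by
    rintro z rfl w
    exact congrArg (fun L => L w) (mfderiv_extChartAt_self (I := 𝓘(ℝ, E)) (x := z))
  have e := extChartAt_to_inv (I := 𝓘(ℝ, E)) x
  refine (h _ e _).trans ?_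
  change VField.raw X _ = _
  rw [e]

theorem DForm.ext_inChart {k : ℕ} {α β : DForm E M k}
    (h : ∀ x, DForm.inChart x α (extChartAt 𝓘(ℝ, E) x x) =
      DForm.inChart x β (extChartAt 𝓘(ℝ, E) x x)) : α = β := by
  funext x
  have := h x
  rwa [DForm.inChart_self, DForm.inChart_self] at this

theorem VField.ext_inChart {X Y : VField E M}
    (h : ∀ x, VField.inChart x X (extChartAt 𝓘(ℝ, E) x x) =
      VField.inChart x Y (extChartAt 𝓘(ℝ, E) x x)) : X = Y := by
  funext x
  have := h x
  rwa [VField.inChart_self, VField.inChart_self] at this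

/-- Over the chart domain at `x₀`, the trivialization of the tangent bundle is the derivative of the
chart, so its fibre component is the chart expression. -/
theorem smoothVField_iff {X : VField E M} :
    SmoothVField X ↔
      ∀ x₀ : M, ContDiffOn ℝ ∞ (VField.inChart x₀ X) (extChartAt 𝓘(ℝ, E) x₀).target := by
  have key : ∀ x₀ : M, ContMDiffOn 𝓘(ℝ, E) (𝓘(ℝ, E).prod 𝓘(ℝ, E)) ∞
      (fun x => (⟨x, X x⟩ : TangentBundle 𝓘(ℝ, E) M)) (chartAt E x₀).source ↔
      ContDiffOn ℝ ∞ (VField.inChart x₀ X) (extChartAt 𝓘(ℝ, E) x₀).target := by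
    intro x₀
    rw [(trivializationAt E (TangentSpace 𝓘(ℝ, E)) x₀).contMDiffOn_section_iff
      (chartAt E x₀).open_source subset_rfl]
    have e : ∀ x ∈ (chartAt E x₀).source,
        ((trivializationAt E (TangentSpace 𝓘(ℝ, E)) x₀) ⟨x, X x⟩).2 =
        mfderiv 𝓘(ℝ, E) 𝓘(ℝ, E) (extChartAt 𝓘(ℝ, E) x₀) x (X x) := by
      intro x hx
      have h := TangentBundle.continuousLinearMapAt_trivializationAt (I := 𝓘(ℝ, E)) hx
      exact (Bundle.Trivialization.continuousLinearMapAt_apply_of_mem (R := ℝ)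
        (trivializationAt E (TangentSpace 𝓘(ℝ, E)) x₀) hx (X x)).symm.trans
        (congrArg (fun L => L (X x)) h)
    rw [contMDiffOn_congr e]
    constructor
    · intro h
      have := h.comp (contMDiffOn_extChartAt_symm (I := 𝓘(ℝ, E)) (n := ∞) x₀)
        (fun y hy => by simpa using (extChartAt 𝓘(ℝ, E) x₀).map_target hy)
      exact contMDiffOn_iff_contDiffOn.1 this
    · intro h
      have := (contMDiffOn_iff_contDiffOn.2 h).comp
        (contMDiffOn_extChartAt (I := 𝓘(ℝ, E)) (n := ∞) (x := x₀))
        (fun x hx => (extChartAt 𝓘(ℝ, E) x₀).map_source (by simpa using hx))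
      refine this.congr fun x hx => ?_
      have e := (extChartAt 𝓘(ℝ, E) x₀).left_inv (x := x) (by simpa using hx)
      have h2 : ∀ z : M, z = x → mfderiv 𝓘(ℝ, E) 𝓘(ℝ, E) (extChartAt 𝓘(ℝ, E) x₀) x (X x) =
          (mfderiv 𝓘(ℝ, E) 𝓘(ℝ, E) (extChartAt 𝓘(ℝ, E) x₀) z (X z) : E) := by
        rintro z rfl; rfl
      exact h2 _ e
  constructor
  · intro h x₀
    exact (key x₀).1 h.contMDiffOn
  · intro h x
    exact ((key x).2 (h x)).contMDiffAt ((chartAt E x).open_source.mem_nhds (mem_chart_source E x))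

theorem inChart_interior {k : ℕ} {x₀ : M} {y : E} (hy : y ∈ (extChartAt 𝓘(ℝ, E) x₀).target)
    (X : VField E M) (α : DForm E M (k + 1)) :
    DForm.inChart x₀ (interior X α) y =
      contract (DForm.inChart x₀ α y) (VField.inChart x₀ X y) := by
  ext v
  rw [DForm.inChart_apply, contract_apply, DForm.inChart_apply]
  change α _ (Fin.cons _ _) = _
  congr 1
  funext i
  refine Fin.cases ?_ (fun j => ?_) i
  · exact (chartD_chartD' hy _).symm
  · rfl

theorem inChart_sharpF [FiniteDimensional ℝ E] {m : ℕ} {x₀ : M} {y : E}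
    (hy : y ∈ (extChartAt 𝓘(ℝ, E) x₀).target) (π : MultiVec E M (m + 1)) (α : DForm E M m) :
    VField.inChart x₀ (sharpF π α) y =
      sharp (MultiVec.inChart x₀ π y) (DForm.inChart x₀ α y) :=
  (sharp_comp (π ((extChartAt 𝓘(ℝ, E) x₀).symm y)) (α ((extChartAt 𝓘(ℝ, E) x₀).symm y))
    (chartD x₀ y) (chartD' x₀ y) (chartD_comp_chartD' hy)).symm

theorem SmoothVField.contDiffAt {X : VField E M} (hX : SmoothVField X) {x₀ : M} {y : E}
    (hy : y ∈ (extChartAt 𝓘(ℝ, E) x₀).target) : ContDiffAt ℝ ∞ (VField.inChart x₀ X) y :=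
  (smoothVField_iff.1 hX x₀).contDiffAt (extChartAt_target_mem_nhds' hy)

theorem SmoothVField.differentiableAt {X : VField E M} (hX : SmoothVField X) {x₀ : M} {y : E}
    (hy : y ∈ (extChartAt 𝓘(ℝ, E) x₀).target) : DifferentiableAt ℝ (VField.inChart x₀ X) y :=
  (hX.contDiffAt hy).differentiableAt (by simp)

theorem two_le_smooth : minSmoothness ℝ 2 ≤ (∞ : WithTop ℕ∞) := by
  simp only [minSmoothness_of_isRCLikeNormedField]
  exact WithTop.coe_le_coe.2 le_top

/-- The exterior derivative is computed in any of the preferred charts. -/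
theorem inChart_extD {k : ℕ} {α : DForm E M k} (hα : SmoothDForm α) {x₀ : M} {y : E}
    (hy : y ∈ (extChartAt 𝓘(ℝ, E) x₀).target) :
    DForm.inChart x₀ (extD α) y = extDeriv (DForm.inChart x₀ α) y := by
  set φ := extChartAt 𝓘(ℝ, E) x₀ with hφ
  set x := φ.symm y with hx
  set ψ := extChartAt 𝓘(ℝ, E) x with hψ
  have hnear : ∀ᶠ z in nhds y, z ∈ φ.target ∧ φ.symm z ∈ (chartAt E x).source := by
    have hc : ContinuousAt φ.symm y := continuousAt_extChartAt_symm'' hy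
    exact Filter.inter_mem (extChartAt_target_mem_nhds' hy)
      (hc.eventually ((chartAt E x).open_source.mem_nhds (mem_chart_source E x)))
  let T : E → (E →L[ℝ] E) := fun z => (mfderiv 𝓘(ℝ, E) 𝓘(ℝ, E) ψ (φ.symm z)).comp
    (mfderiv 𝓘(ℝ, E) 𝓘(ℝ, E) φ.symm z)
  have hτ : ∀ z, z ∈ φ.target ∧ φ.symm z ∈ (chartAt E x).source →
      HasFDerivAt (fun z => ψ (φ.symm z)) (T z) z := by
    rintro z ⟨hz, hz'⟩
    have h1 : MDifferentiableAt 𝓘(ℝ, E) 𝓘(ℝ, E) φ.symm z :=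
      (mdifferentiableOn_extChartAt_symm z hz).mdifferentiableAt (extChartAt_target_mem_nhds' hz)
    have h2 : MDifferentiableAt 𝓘(ℝ, E) 𝓘(ℝ, E) ψ (φ.symm z) := mdifferentiableAt_extChartAt hz'
    have h3 := HasMFDerivAt.comp z h2.hasMFDerivAt h1.hasMFDerivAt
    exact @HasMFDerivAt.hasFDerivAt ℝ _ E _ _ E _ _ _ _ _ h3
  -- `extD` at `x` uses the chart `ψ` centred at `x`. Near `y` the two chart expressions differ by
  -- pullback along the transition map `ψ ∘ φ.symm`, and the exterior derivative commutes with this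
  -- pullback.
  have hpull : DForm.inChart x₀ α =ᶠ[nhds y] fun z =>
      (DForm.inChart x α (ψ (φ.symm z))).compContinuousLinearMap
        (fderiv ℝ (fun z => ψ (φ.symm z)) z) := by
    filter_upwards [hnear] with z hz
    rw [(hτ z hz).fderiv]
    have e : ψ.symm (ψ (φ.symm z)) = φ.symm z := ψ.left_inv (by simpa [hψ] using hz.2)
    have h3 := mfderivWithin_extChartAt_symm_comp_mfderiv_extChartAt' (I := 𝓘(ℝ, E)) (x := x)
      (y := φ.symm z) (by simpa using hz.2)
    rw [modelWithCornersSelf_coe, range_id, mfderivWithin_univ] at h3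
    ext v
    change DForm.raw α (φ.symm z) (fun i => mfderiv 𝓘(ℝ, E) 𝓘(ℝ, E) φ.symm z (v i)) =
      DForm.raw α (ψ.symm (ψ (φ.symm z))) (fun i => mfderiv 𝓘(ℝ, E) 𝓘(ℝ, E) ψ.symm
        (ψ (φ.symm z)) (mfderiv 𝓘(ℝ, E) 𝓘(ℝ, E) ψ (φ.symm z)
          (mfderiv 𝓘(ℝ, E) 𝓘(ℝ, E) φ.symm z (v i))))
    rw [e]
    congr 1
    funext i
    exact (congrArg (fun L => L (mfderiv 𝓘(ℝ, E) 𝓘(ℝ, E) φ.symm z (v i))) h3).symm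
  have hxt : ψ x ∈ ψ.target := mem_extChartAt_target x
  have hsm : ContDiffAt ℝ ∞ (fun z => ψ (φ.symm z)) y := by
    have h1 : ContMDiffAt 𝓘(ℝ, E) 𝓘(ℝ, E) ∞ φ.symm y :=
      (contMDiffOn_extChartAt_symm x₀).contMDiffAt (extChartAt_target_mem_nhds' hy)
    have h2 : ContMDiffAt 𝓘(ℝ, E) 𝓘(ℝ, E) ∞ ψ (φ.symm y) :=
      contMDiffAt_extChartAt' (mem_chart_source E x)
    exact contMDiffAt_iff_contDiffAt.1 (ContMDiffAt.comp y h2 h1)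
  rw [hpull.extDeriv_eq,
    extDeriv_pullback (f := fun z => ψ (φ.symm z)) (hα.differentiableAt hxt) hsm two_le_smooth]
  rw [(hτ y hnear.self_of_nhds).fderiv]
  rfl

end Charts

/-! ### Smooth sections are closed under the operations -/

section Smooth

open Set VectorField

variable {E : Type*} [NormedAddCommGroup E] [NormedSpace ℝ E]
  {M : Type*} [TopologicalSpace M] [ChartedSpace E M]

theorem contDiffOn_clm_comp {F G H : Type*} [NormedAddCommGroup F] [NormedSpace ℝ F]
    [NormedAddCommGroup G] [NormedSpace ℝ G] [NormedAddCommGroup H] [NormedSpace ℝ H]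
    (L : G →L[ℝ] H) {f : F → G} {s : Set F} {n : WithTop ℕ∞} (h : ContDiffOn ℝ n f s) :
    ContDiffOn ℝ n (fun y => L (f y)) s :=
  L.contDiff.comp_contDiffOn h

theorem SmoothDForm.add {k : ℕ} {α β : DForm E M k} (hα : SmoothDForm α) (hβ : SmoothDForm β) :
    SmoothDForm (α + β) := fun x₀ => (hα x₀).add (hβ x₀)

theorem SmoothDForm.sub {k : ℕ} {α β : DForm E M k} (hα : SmoothDForm α) (hβ : SmoothDForm β) :
    SmoothDForm (α - β) := fun x₀ => (hα x₀).sub (hβ x₀)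

theorem SmoothDForm.const_smul {k : ℕ} (c : ℝ) {α : DForm E M k} (hα : SmoothDForm α) :
    SmoothDForm (c • α) := fun x₀ => by
  change ContDiffOn ℝ ∞ (fun y => c • DForm.inChart x₀ α y) _
  exact ContDiffOn.smul (f := fun _ : E => c) contDiffOn_const (hα x₀)

theorem SmoothDForm.zero {k : ℕ} : SmoothDForm (0 : DForm E M k) := fun x₀ => by
  change ContDiffOn ℝ ∞ (fun _ => (0 : E [⋀^Fin k]→L[ℝ] ℝ)) (extChartAt 𝓘(ℝ, E) x₀).target
  exact contDiffOn_const

/-! ### The interior product -/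

section Interior

variable {k : ℕ}

theorem interior_add_left (X Y : VField E M) (α : DForm E M (k + 1)) :
    interior (X + Y) α = interior X α + interior Y α :=
  funext fun x => ContinuousAlternatingMap.ext fun v =>
    congrArg (fun A => A v) ((α x).toAlternatingMap.curryLeft.map_add (X x) (Y x))

theorem interior_smul_left (f : M → ℝ) (X : VField E M) (α : DForm E M (k + 1)) :
    interior (fun x => f x • X x) α = fun x => f x • interior X α x :=
  funext fun x => ContinuousAlternatingMap.ext fun v =>
    congrArg (fun A => A v) ((α x).toAlternatingMap.curryLeft.map_smul (f x) (X x))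

theorem interior_add_right (X : VField E M) (α β : DForm E M (k + 1)) :
    interior X (α + β) = interior X α + interior X β := rfl

theorem interior_sub_right (X : VField E M) (α β : DForm E M (k + 1)) :
    interior X (α - β) = interior X α - interior X β := rfl

theorem interior_smul_right (f : M → ℝ) (X : VField E M) (α : DForm E M (k + 1)) :
    interior X (fun x => f x • α x) = fun x => f x • interior X α x := rfl

theorem interior_zero_right (X : VField E M) : interior X (0 : DForm E M (k + 1)) = 0 := rfl

theorem interior_interior (X Y : VField E M) (α : DForm E M (k + 2)) :
    interior X (interior Y α) = - interior Y (interior X α) := by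
  funext x
  ext v
  have h := (α x).map_swap (Fin.cons (Y x) (Fin.cons (X x) v) : Fin (k + 2) → _)
    (i := 0) (j := 1) (by simp)
  change α x (Fin.cons (Y x) (Fin.cons (X x) v)) = - α x (Fin.cons (X x) (Fin.cons (Y x) v))
  refine neg_eq_iff_eq_neg.1 (h.symm.trans (congrArg (α x) (funext fun i => ?_)))
  refine Fin.cases ?_ (fun j => Fin.cases ?_ (fun l => ?_) j) i
  · simp
  · simp
  · rw [Function.comp_apply, Equiv.swap_apply_of_ne_of_ne (Fin.succ_ne_zero _)]
    · rfl
    · exact fun h => Fin.succ_ne_zero l (Fin.succ_injective _ h)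

theorem lieD_eq_succ (X : VField E M) (α : DForm E M (k + 1)) :
    lieD X α = interior X (extD α) + extD (interior X α) := rfl

end Interior

/-! ### Closure of smooth vector fields and forms under the operations -/

variable [IsManifold 𝓘(ℝ, E) ∞ M]

theorem contDiffOn_comp_chart {f : M → ℝ} (hf : ContMDiff 𝓘(ℝ, E) 𝓘(ℝ, ℝ) ∞ f) (x₀ : M) :
    ContDiffOn ℝ ∞ (fun y => f ((extChartAt 𝓘(ℝ, E) x₀).symm y)) (extChartAt 𝓘(ℝ, E) x₀).target :=
  contMDiffOn_iff_contDiffOn.1 (hf.comp_contMDiffOn (contMDiffOn_extChartAt_symm x₀))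

theorem fderiv_comp_chart {f : M → ℝ} (hf : ContMDiff 𝓘(ℝ, E) 𝓘(ℝ, ℝ) ∞ f) {x₀ : M} {y : E}
    (hy : y ∈ (extChartAt 𝓘(ℝ, E) x₀).target) :
    fderiv ℝ (fun y => f ((extChartAt 𝓘(ℝ, E) x₀).symm y)) y =
      (dfun f ((extChartAt 𝓘(ℝ, E) x₀).symm y)).comp (chartD x₀ y) := by
  have h1 : MDifferentiableAt 𝓘(ℝ, E) 𝓘(ℝ, E) (extChartAt 𝓘(ℝ, E) x₀).symm y :=
    (mdifferentiableOn_extChartAt_symm y hy).mdifferentiableAt (extChartAt_target_mem_nhds' hy)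
  have h2 : MDifferentiableAt 𝓘(ℝ, E) 𝓘(ℝ, ℝ) f ((extChartAt 𝓘(ℝ, E) x₀).symm y) :=
    hf.contMDiffAt.mdifferentiableAt (by simp)
  have h3 := HasMFDerivAt.comp y h2.hasMFDerivAt h1.hasMFDerivAt
  exact HasFDerivAt.fderiv (f' := ((dfun f ((extChartAt 𝓘(ℝ, E) x₀).symm y)).comp
    (chartD x₀ y) : E →L[ℝ] ℝ)) (@HasMFDerivAt.hasFDerivAt ℝ _ E _ _ ℝ _ _ _ _ _ h3)

theorem SmoothDForm.smul {k : ℕ} {f : M → ℝ} (hf : ContMDiff 𝓘(ℝ, E) 𝓘(ℝ, ℝ) ∞ f)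
    {α : DForm E M k} (hα : SmoothDForm α) : SmoothDForm (fun x => f x • α x) :=
  fun x₀ => (contDiffOn_comp_chart hf x₀).smul (hα x₀)

theorem SmoothVField.add {X Y : VField E M} (hX : SmoothVField X) (hY : SmoothVField Y) :
    SmoothVField (X + Y) := smoothVField_iff.2 fun x₀ =>
  ((smoothVField_iff.1 hX x₀).add (smoothVField_iff.1 hY x₀)).congr fun y _ =>
    VField.inChart_add x₀ X Y y

theorem SmoothVField.smul {f : M → ℝ} (hf : ContMDiff 𝓘(ℝ, E) 𝓘(ℝ, ℝ) ∞ f) {X : VField E M}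
    (hX : SmoothVField X) : SmoothVField (fun x => f x • X x) := smoothVField_iff.2 fun x₀ =>
  ((contDiffOn_comp_chart hf x₀).smul (smoothVField_iff.1 hX x₀)).congr fun y _ =>
    VField.inChart_smul x₀ f X y

theorem SmoothVField.const_smul (c : ℝ) {X : VField E M} (hX : SmoothVField X) :
    SmoothVField (c • X) := SmoothVField.smul (f := fun _ => c) contMDiff_const hX

theorem SmoothVField.sub {X Y : VField E M} (hX : SmoothVField X) (hY : SmoothVField Y) :
    SmoothVField (X - Y) := by
  have := hX.add (hY.const_smul (-1))
  rwa [neg_one_smul, ← sub_eq_add_neg] at this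

theorem SmoothVField.zero : SmoothVField (0 : VField E M) :=
  Bundle.contMDiff_zeroSection ℝ (TangentSpace 𝓘(ℝ, E) : M → Type _)

theorem SmoothDForm.interior {k : ℕ} {X : VField E M} {α : DForm E M (k + 1)}
    (hX : SmoothVField X) (hα : SmoothDForm α) : SmoothDForm (interior X α) := by
  intro x₀
  have h1 : ContDiffOn ℝ ∞ (fun y => (DForm.inChart x₀ α y).curryLeft)
      (extChartAt 𝓘(ℝ, E) x₀).target :=
    contDiffOn_clm_comp (G := E [⋀^Fin (k + 1)]→L[ℝ] ℝ) (H := E →L[ℝ] E [⋀^Fin k]→L[ℝ] ℝ)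
      (ContinuousAlternatingMap.curryLeftLI (𝕜 := ℝ) (E := E) (F := ℝ)
        (n := k)).toContinuousLinearMap (hα x₀)
  exact (h1.clm_apply (smoothVField_iff.1 hX x₀)).congr fun y hy => inChart_interior hy X α

theorem SmoothDForm.extD {k : ℕ} {α : DForm E M k} (hα : SmoothDForm α) :
    SmoothDForm (extD α) := by
  intro x₀
  have h1 : ContDiffOn ℝ ∞ (fderiv ℝ (DForm.inChart x₀ α)) (extChartAt 𝓘(ℝ, E) x₀).target :=
    (hα x₀).fderiv_of_isOpen (isOpen_extChartAt_target x₀) (by simp)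
  have h2 : ContDiffOn ℝ ∞ (fun y => extDeriv (DForm.inChart x₀ α) y)
      (extChartAt 𝓘(ℝ, E) x₀).target :=
    contDiffOn_clm_comp (G := E →L[ℝ] E [⋀^Fin k]→L[ℝ] ℝ) (H := E [⋀^Fin (k + 1)]→L[ℝ] ℝ)
      (ContinuousAlternatingMap.alternatizeUncurryFinCLM ℝ E ℝ) h1
  exact h2.congr fun y hy => inChart_extD hα hy

theorem SmoothDForm.lieD {X : VField E M} (hX : SmoothVField X) :
    ∀ {k : ℕ} {α : DForm E M k}, SmoothDForm α → SmoothDForm (lieD X α)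
  | 0, _, hα => SmoothDForm.interior hX hα.extD
  | _ + 1, _, hα => (SmoothDForm.interior hX hα.extD).add (SmoothDForm.interior hX hα).extD

theorem SmoothVField.mdifferentiableAt {X : VField E M} (hX : SmoothVField X) (x : M) :
    MDifferentiableAt 𝓘(ℝ, E) (𝓘(ℝ, E).prod 𝓘(ℝ, E))
      (fun x => (⟨x, X x⟩ : TangentBundle 𝓘(ℝ, E) M)) x :=
  hX.contMDiffAt.mdifferentiableAt (by simp)

theorem isManifold_minSmoothness_two : IsManifold 𝓘(ℝ, E) (minSmoothness ℝ 2) M :=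
  IsManifold.of_le (n := ∞) two_le_smooth

theorem isManifold_minSmoothness_three : IsManifold 𝓘(ℝ, E) (minSmoothness ℝ 3) M :=
  IsManifold.of_le (n := ∞) (by
    simp only [minSmoothness_of_isRCLikeNormedField]
    exact WithTop.coe_le_coe.2 le_top)

/-- Makes the naturality of `mlieBracket` under pullback available for chart expressions. -/
theorem mpullback_chart_symm {x₀ : M} {y : E} (hy : y ∈ (extChartAt 𝓘(ℝ, E) x₀).target)
    (X : VField E M) :
    mpullback 𝓘(ℝ, E) 𝓘(ℝ, E) (extChartAt 𝓘(ℝ, E) x₀).symm X y = VField.inChart x₀ X y := by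
  have : (chartD x₀ y).inverse = chartD' x₀ y :=
    ContinuousLinearMap.inverse_eq (chartD_comp_chartD' hy) (chartD'_comp_chartD hy)
  exact congrArg (fun L => L (X ((extChartAt 𝓘(ℝ, E) x₀).symm y))) this

/-! ### Cartan calculus -/

theorem inChart_interior_eventuallyEq {k : ℕ} {x₀ : M} {y : E}
    (hy : y ∈ (extChartAt 𝓘(ℝ, E) x₀).target) (X : VField E M) (α : DForm E M (k + 1)) :
    DForm.inChart x₀ (interior X α) =ᶠ[nhds y]
      fun z => contract (DForm.inChart x₀ α z) (VField.inChart x₀ X z) := by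
  filter_upwards [extChartAt_target_mem_nhds' hy] with z hz using inChart_interior hz X α

/-- Identifies the Lie derivative, defined on `M` by Cartan's formula, with an explicit first-order
operator, from which the Leibniz rules are read off. -/
theorem inChart_lieD {X : VField E M} (hX : SmoothVField X) {x₀ : M} {y : E}
    (hy : y ∈ (extChartAt 𝓘(ℝ, E) x₀).target) :
    ∀ {k : ℕ} {α : DForm E M k}, SmoothDForm α →
      DForm.inChart x₀ (lieD X α) y = flatLie (VField.inChart x₀ X) (DForm.inChart x₀ α) y
  | 0, α, hα => by
    rw [← cartan_zero, lieD, inChart_interior hy, inChart_extD hα hy]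
  | _ + 1, α, hα => by
    rw [← cartan (hα.differentiableAt hy) (hX.differentiableAt hy), lieD, DForm.inChart_add,
      inChart_interior hy, inChart_extD hα hy, inChart_extD (hα.interior hX) hy,
      (inChart_interior_eventuallyEq hy X α).extDeriv_eq]

theorem extD_add {k : ℕ} {α β : DForm E M k} (hα : SmoothDForm α) (hβ : SmoothDForm β) :
    extD (α + β) = extD α + extD β := by
  refine DForm.ext_inChart fun x => ?_
  have hy := mem_extChartAt_target (I := 𝓘(ℝ, E)) x
  rw [DForm.inChart_add, inChart_extD (hα.add hβ) hy, inChart_extD hα hy, inChart_extD hβ hy]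
  exact extDeriv_add (hα.differentiableAt hy) (hβ.differentiableAt hy)

theorem extD_const_smul {k : ℕ} (c : ℝ) {α : DForm E M k} (hα : SmoothDForm α) :
    extD (c • α) = c • extD α := by
  refine DForm.ext_inChart fun x => ?_
  have hy := mem_extChartAt_target (I := 𝓘(ℝ, E)) x
  rw [inChart_extD (hα.const_smul c) hy]
  refine (extDeriv_smul c (DForm.inChart x α)).trans ?_
  rw [← inChart_extD hα hy]
  rfl

theorem extD_sub {k : ℕ} {α β : DForm E M k} (hα : SmoothDForm α) (hβ : SmoothDForm β) :
    extD (α - β) = extD α - extD β := by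
  rw [sub_eq_add_neg, ← neg_one_smul ℝ β, extD_add hα (hβ.const_smul _), extD_const_smul _ hβ,
    neg_one_smul ℝ (extD β), ← sub_eq_add_neg]

theorem extD_extD {k : ℕ} {α : DForm E M k} (hα : SmoothDForm α) : extD (extD α) = 0 := by
  refine DForm.ext_inChart fun x => ?_
  have hy := mem_extChartAt_target (I := 𝓘(ℝ, E)) x
  have h : DForm.inChart x (extD α) =ᶠ[nhds (extChartAt 𝓘(ℝ, E) x x)]
      extDeriv (DForm.inChart x α) := by
    filter_upwards [extChartAt_target_mem_nhds' hy] with z hz using inChart_extD hα hz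
  rw [inChart_extD hα.extD hy, h.extDeriv_eq, extDeriv_extDeriv_apply (hα.contDiffAt hy)
    two_le_smooth]
  rfl

variable {k : ℕ} {X Y : VField E M}

theorem lieD_add {α β : DForm E M k} (hX : SmoothVField X) (hα : SmoothDForm α)
    (hβ : SmoothDForm β) : lieD X (α + β) = lieD X α + lieD X β := by
  refine DForm.ext_inChart fun x => ?_
  have hy := mem_extChartAt_target (I := 𝓘(ℝ, E)) x
  have h : DForm.inChart x (α + β) = fun y => DForm.inChart x α y + DForm.inChart x β y := rfl
  rw [DForm.inChart_add, inChart_lieD hX hy (hα.add hβ), inChart_lieD hX hy hα,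
    inChart_lieD hX hy hβ, h]
  exact flatLie_add (hα.differentiableAt hy) (hβ.differentiableAt hy)

theorem lieD_smul {f : M → ℝ} (hf : ContMDiff 𝓘(ℝ, E) 𝓘(ℝ, ℝ) ∞ f) {α : DForm E M k}
    (hX : SmoothVField X) (hα : SmoothDForm α) :
    lieD X (fun x => f x • α x) = fun x => f x • lieD X α x + dfun f x (X x) • α x := by
  refine DForm.ext_inChart fun x => ?_
  have hy := mem_extChartAt_target (I := 𝓘(ℝ, E)) x
  have h : DForm.inChart x (fun x => f x • α x) =
    fun y => f ((extChartAt 𝓘(ℝ, E) x).symm y) • DForm.inChart x α y := rfl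
  rw [inChart_lieD hX hy (hα.smul hf), h, flatLie_smul
    (((contDiffOn_comp_chart hf x).contDiffAt (extChartAt_target_mem_nhds' hy)).differentiableAt
      (by simp)) (hα.differentiableAt hy), ← inChart_lieD hX hy hα, fderiv_comp_chart hf hy]
  refine congrArg₂ (· + ·) rfl (congrArg (fun c => c • DForm.inChart x α _) ?_)
  exact congrArg (dfun f _) (chartD_chartD' hy _)

theorem lieD_const_smul (c : ℝ) {α : DForm E M k} (hX : SmoothVField X) (hα : SmoothDForm α) :
    lieD X (c • α) = c • lieD X α := by
  refine (lieD_smul (f := fun _ => c) contMDiff_const hX hα).trans ?_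
  funext x
  have : dfun (E := E) (fun _ : M => c) x = 0 := mvfderiv_const c
  rw [this, zero_apply, zero_smul, add_zero]
  rfl

theorem lieD_sub {α β : DForm E M k} (hX : SmoothVField X) (hα : SmoothDForm α)
    (hβ : SmoothDForm β) : lieD X (α - β) = lieD X α - lieD X β := by
  rw [sub_eq_add_neg, ← neg_one_smul ℝ β, lieD_add hX hα (hβ.const_smul _),
    lieD_const_smul _ hX hβ, neg_one_smul ℝ (lieD X β), ← sub_eq_add_neg]

theorem lieD_add_left {α : DForm E M k} (hX : SmoothVField X) (hY : SmoothVField Y)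
    (hα : SmoothDForm α) : lieD (X + Y) α = lieD X α + lieD Y α := by
  cases k with
  | zero => exact interior_add_left X Y _
  | succ k =>
    simp only [lieD, interior_add_left, extD_add (hα.interior hX) (hα.interior hY)]
    abel

theorem lieD_const_smul_left (c : ℝ) {α : DForm E M k} (hX : SmoothVField X)
    (hα : SmoothDForm α) : lieD (c • X) α = c • lieD X α := by
  have h : ∀ {l : ℕ} (β : DForm E M (l + 1)), interior (c • X) β = c • interior X β :=
    fun β => interior_smul_left (fun _ => c) X β
  cases k with
  | zero => exact h _
  | succ k => simp only [lieD, h, extD_const_smul c (hα.interior hX), smul_add]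

theorem lieD_extD {α : DForm E M k} (hX : SmoothVField X) (hα : SmoothDForm α) :
    lieD X (extD α) = extD (lieD X α) := by
  cases k with
  | zero =>
    refine (congrArg (fun β => interior X β + extD (interior X (extD α))) (extD_extD hα)).trans ?_
    exact zero_add _
  | succ k =>
    rw [lieD_eq_succ, lieD_eq_succ, extD_extD hα, interior_zero_right, zero_add,
      extD_add (hα.extD.interior hX) (hα.interior hX).extD, extD_extD (hα.interior hX), add_zero]

/-! ### The Lie bracket in charts and its commutation rules with forms -/

variable [FiniteDimensional ℝ E]

/-- The Lie bracket is computed in any of the preferred charts. -/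
theorem inChart_lie (hX : SmoothVField X) (hY : SmoothVField Y) {x₀ : M} {y : E}
    (hy : y ∈ (extChartAt 𝓘(ℝ, E) x₀).target) :
    VField.inChart x₀ (lie X Y) y =
      lieBracket ℝ (VField.inChart x₀ X) (VField.inChart x₀ Y) y := by
  have : IsManifold 𝓘(ℝ, E) (minSmoothness ℝ 2) M := isManifold_minSmoothness_two
  have : CompleteSpace E := FiniteDimensional.complete ℝ E
  have h1 := mpullback_mlieBracket (I := 𝓘(ℝ, E)) (I' := 𝓘(ℝ, E)) (n := ∞)
    (f := (extChartAt 𝓘(ℝ, E) x₀).symm) (x₀ := y) (V := X) (W := Y)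
    (hX.mdifferentiableAt _) (hY.mdifferentiableAt _)
    ((contMDiffOn_extChartAt_symm x₀).contMDiffAt (extChartAt_target_mem_nhds' hy)) two_le_smooth
  have h2 : ∀ V W : E → E, (mlieBracket 𝓘(ℝ, E) (M := E) V W y : E) = lieBracket ℝ V W y :=
    fun V W => (congrFun (mlieBracketWithin_eq_lieBracketWithin (𝕜 := ℝ) (E := E) (s := univ)
      (V := V) (W := W)) y).trans (congrFun (lieBracketWithin_univ (𝕜 := ℝ) (V := V) (W := W)) y)
  have h3 : VField.inChart x₀ (lie X Y) y =
      lieBracket ℝ (mpullback 𝓘(ℝ, E) 𝓘(ℝ, E) (extChartAt 𝓘(ℝ, E) x₀).symm X : E → E)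
        (mpullback 𝓘(ℝ, E) 𝓘(ℝ, E) (extChartAt 𝓘(ℝ, E) x₀).symm Y : E → E) y :=
    (mpullback_chart_symm hy (lie X Y)).symm.trans (h1.trans (h2 _ _))
  rw [h3]
  refine Filter.EventuallyEq.lieBracket_vectorField_eq ?_ ?_
  · filter_upwards [extChartAt_target_mem_nhds' hy] with z hz using mpullback_chart_symm hz X
  · filter_upwards [extChartAt_target_mem_nhds' hy] with z hz using mpullback_chart_symm hz Y

theorem SmoothVField.lie (hX : SmoothVField X) (hY : SmoothVField Y) :
    SmoothVField (lie X Y) := by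
  refine smoothVField_iff.2 fun x₀ y hy => ?_
  have := ContDiffAt.lieBracket_vectorField (m := ∞) (hX.contDiffAt hy) (hY.contDiffAt hy) (by simp)
  refine (this.congr_of_eventuallyEq ?_).contDiffWithinAt
  filter_upwards [extChartAt_target_mem_nhds' hy] with z hz using inChart_lie hX hY hz

theorem SmoothVField.sharpF {m : ℕ} {π : MultiVec E M (m + 1)} {α : DForm E M m}
    (hπ : SmoothMultiVec π) (hα : SmoothDForm α) : SmoothVField (sharpF π α) := by
  refine smoothVField_iff.2 fun x₀ => ?_
  have h1 : ContDiffOn ℝ ∞ (fun y => sharpL E m (MultiVec.inChart x₀ π y))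
      (extChartAt 𝓘(ℝ, E) x₀).target :=
    contDiffOn_clm_comp (G := (E →L[ℝ] ℝ) [⋀^Fin (m + 1)]→L[ℝ] ℝ)
      (H := (E [⋀^Fin m]→L[ℝ] ℝ) →L[ℝ] E) (sharpL E m) (hπ x₀)
  refine (h1.clm_apply (hα x₀)).congr fun y hy => ?_
  rw [inChart_sharpF hy, sharpL_apply]

theorem lieD_interior {α : DForm E M (k + 1)} (hX : SmoothVField X) (hY : SmoothVField Y)
    (hα : SmoothDForm α) :
    lieD X (interior Y α) = interior Y (lieD X α) + interior (lie X Y) α := by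
  refine DForm.ext_inChart fun x => ?_
  have hy := mem_extChartAt_target (I := 𝓘(ℝ, E)) x
  rw [DForm.inChart_add, inChart_lieD hX hy (hα.interior hY), inChart_interior hy,
    inChart_interior hy, inChart_lie hX hY hy, inChart_lieD hX hy hα,
    ← flatLie_contract (hα.differentiableAt hy) (hY.differentiableAt hy)]
  have h := inChart_interior_eventuallyEq hy Y α
  rw [flatLie, flatLie, h.fderiv_eq, h.self_of_nhds]

/-- A formal consequence of `[L_X, d] = 0` and `[L_X, i_Y] = i_{[X, Y]}`, by Cartan's formula. -/
theorem lieD_lieD {α : DForm E M k} (hX : SmoothVField X) (hY : SmoothVField Y)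
    (hα : SmoothDForm α) :
    lieD X (lieD Y α) = lieD (lie X Y) α + lieD Y (lieD X α) := by
  cases k with
  | zero =>
    change lieD X (interior Y (extD α)) =
      interior (lie X Y) (extD α) + interior Y (extD (lieD X α))
    rw [lieD_interior hX hY hα.extD, lieD_extD hX hα, add_comm]
  | succ k =>
    rw [lieD_eq_succ Y α, lieD_eq_succ Y (lieD X α), lieD_eq_succ (lie X Y) α,
      lieD_add hX (hα.extD.interior hY) (hα.interior hY).extD, lieD_interior hX hY hα.extD,
      lieD_extD hX hα, lieD_extD hX (hα.interior hY), lieD_interior hX hY hα,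
      extD_add ((hα.lieD hX).interior hY) (hα.interior (hX.lie hY))]
    abel

theorem lieD_interior_extD {α : DForm E M k} (hX : SmoothVField X) (hY : SmoothVField Y)
    (hα : SmoothDForm α) :
    lieD X (interior Y (extD α)) = interior Y (extD (lieD X α)) + interior (lie X Y) (extD α) := by
  rw [lieD_interior hX hY hα.extD, lieD_extD hX hα]

end Smooth

section Brackets

open Set VectorField

variable {E : Type*} [NormedAddCommGroup E] [NormedSpace ℝ E]
  {M : Type*} [TopologicalSpace M] [ChartedSpace E M]

/-! ### The Lie bracket of smooth vector fields -/

theorem lie_swap (X Y : VField E M) : lie X Y = - lie Y X := mlieBracket_swap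

theorem lie_self (X : VField E M) : lie X X = 0 := mlieBracket_self

section

variable [IsManifold 𝓘(ℝ, E) ∞ M] [FiniteDimensional ℝ E] {X Y Z : VField E M}

theorem lie_add_left (hX : SmoothVField X) (hY : SmoothVField Y) :
    lie (X + Y) Z = lie X Z + lie Y Z := by
  have : IsManifold 𝓘(ℝ, E) (minSmoothness ℝ 2) M := isManifold_minSmoothness_two
  have : CompleteSpace E := FiniteDimensional.complete ℝ E
  funext x
  exact mlieBracket_add_left (hX.mdifferentiableAt x) (hY.mdifferentiableAt x)

theorem lie_add_right (hY : SmoothVField Y) (hZ : SmoothVField Z) :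
    lie X (Y + Z) = lie X Y + lie X Z := by
  rw [lie_swap, lie_add_left hY hZ, lie_swap Y, lie_swap Z]
  abel

theorem lie_const_smul_left (c : ℝ) (hX : SmoothVField X) : lie (c • X) Y = c • lie X Y := by
  have : IsManifold 𝓘(ℝ, E) (minSmoothness ℝ 2) M := isManifold_minSmoothness_two
  have : CompleteSpace E := FiniteDimensional.complete ℝ E
  funext x
  exact mlieBracket_const_smul_left (hX.mdifferentiableAt x)

theorem lie_const_smul_right (c : ℝ) (hY : SmoothVField Y) : lie X (c • Y) = c • lie X Y := by
  rw [lie_swap, lie_const_smul_left c hY, lie_swap Y, smul_neg, neg_neg]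

theorem lie_smul_right {f : M → ℝ} (hf : ContMDiff 𝓘(ℝ, E) 𝓘(ℝ, ℝ) ∞ f) (hY : SmoothVField Y) :
    lie X (fun x => f x • Y x) = fun x => f x • lie X Y x + dfun f x (X x) • Y x := by
  have : IsManifold 𝓘(ℝ, E) (minSmoothness ℝ 2) M := isManifold_minSmoothness_two
  have : CompleteSpace E := FiniteDimensional.complete ℝ E
  funext x
  exact (mlieBracket_smul_right (hf.contMDiffAt.mdifferentiableAt (by simp))
    (hY.mdifferentiableAt x)).trans (add_comm _ _)

theorem lie_jacobi (hX : SmoothVField X) (hY : SmoothVField Y) (hZ : SmoothVField Z) :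
    lie X (lie Y Z) = lie (lie X Y) Z + lie Y (lie X Z) := by
  have : IsManifold 𝓘(ℝ, E) (minSmoothness ℝ 3) M := isManifold_minSmoothness_three
  have : CompleteSpace E := FiniteDimensional.complete ℝ E
  have h : ∀ {W : VField E M}, SmoothVField W → ∀ x, ContMDiffAt 𝓘(ℝ, E) (𝓘(ℝ, E).prod 𝓘(ℝ, E))
      (minSmoothness ℝ 2) (fun x => (⟨x, W x⟩ : TangentBundle 𝓘(ℝ, E) M)) x :=
    fun hW x => hW.contMDiffAt.of_le two_le_smooth
  funext x
  exact leibniz_identity_mlieBracket_apply (h hX x) (h hY x) (h hZ x)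

end

/-! ### The higher Dorfman bracket -/

theorem Sec.ext {k : ℕ} {e₁ e₂ : Sec E M k} (h : e₁.vec = e₂.vec) (h' : e₁.form = e₂.form) :
    e₁ = e₂ :=
  funext fun x => Prod.ext (congrFun h x) (congrFun h' x)

section

variable [IsManifold 𝓘(ℝ, E) ∞ M] {k : ℕ} {e₁ e₂ e₃ : Sec E M k}

theorem smoothSec_add (h₁ : e₁ ∈ smoothSec E M k) (h₂ : e₂ ∈ smoothSec E M k) :
    e₁ + e₂ ∈ smoothSec E M k := ⟨h₁.1.add h₂.1, h₁.2.add h₂.2⟩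

theorem smoothSec_const_smul (c : ℝ) (h₁ : e₁ ∈ smoothSec E M k) :
    c • e₁ ∈ smoothSec E M k := ⟨h₁.1.const_smul c, h₁.2.const_smul c⟩

theorem smoothSec_smul {f : M → ℝ} (hf : ContMDiff 𝓘(ℝ, E) 𝓘(ℝ, ℝ) ∞ f)
    (h₁ : e₁ ∈ smoothSec E M k) : (fun x => f x • e₁ x) ∈ smoothSec E M k :=
  ⟨SmoothVField.smul hf h₁.1, SmoothDForm.smul hf h₁.2⟩

variable [FiniteDimensional ℝ E]

/-- The vector part is the Jacobi identity. In the form part, the terms in the form of `e₃` match by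
`lieD_lieD` and those of `e₂` by `lieD_interior_extD`. Those of `e₁` match because `dα` is closed,
so that `L_Y dα = d i_Y dα`. -/
theorem dorfman_leibniz (h₁ : e₁ ∈ smoothSec E M k) (h₂ : e₂ ∈ smoothSec E M k)
    (h₃ : e₃ ∈ smoothSec E M k) :
    dorfman e₁ (dorfman e₂ e₃) = dorfman (dorfman e₁ e₂) e₃ + dorfman e₂ (dorfman e₁ e₃) := by
  refine Sec.ext (lie_jacobi h₁.1 h₂.1 h₃.1) ?_
  change lieD e₁.vec (lieD e₂.vec e₃.form - interior e₃.vec (extD e₂.form)) -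
      interior (lie e₂.vec e₃.vec) (extD e₁.form) =
    (lieD (lie e₁.vec e₂.vec) e₃.form -
      interior e₃.vec (extD (lieD e₁.vec e₂.form - interior e₂.vec (extD e₁.form)))) +
    (lieD e₂.vec (lieD e₁.vec e₃.form - interior e₃.vec (extD e₁.form)) -
      interior (lie e₁.vec e₃.vec) (extD e₂.form))
  have hc := lieD_interior (X := e₂.vec) (Y := e₃.vec) (α := extD e₁.form) h₂.1 h₃.1 h₁.2.extD
  have hd : lieD e₂.vec (extD e₁.form) = extD (interior e₂.vec (extD e₁.form)) := by
    have := lieD_eq_succ e₂.vec (extD e₁.form)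
    rwa [extD_extD h₁.2, interior_zero_right, zero_add] at this
  rw [lieD_sub h₁.1 (h₃.2.lieD h₂.1) (h₂.2.extD.interior h₃.1),
    lieD_sub h₂.1 (h₃.2.lieD h₁.1) (h₁.2.extD.interior h₃.1),
    extD_sub (h₂.2.lieD h₁.1) (h₁.2.extD.interior h₂.1), interior_sub_right,
    lieD_lieD h₁.1 h₂.1 h₃.2, lieD_interior_extD h₁.1 h₃.1 h₂.2, hc, hd]
  abel

theorem isLeibnizAlgebroid_dorfman :
    IsLeibnizAlgebroid (smoothSec E M k) dorfman (fun _ => LinearMap.fst ℝ _ _) where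
  anchor_smooth _ h := h.1
  bracket_mem _ h₁ _ h₂ := ⟨h₁.1.lie h₂.1, (h₂.2.lieD h₁.1).sub (h₁.2.extD.interior h₂.1)⟩
  add_bracket (e₁ : Sec E M k) h₁ (e₂ : Sec E M k) h₂ (e₃ : Sec E M k) h₃ := by
    refine Sec.ext (lie_add_left h₁.1 h₂.1) ?_
    change lieD (e₁.vec + e₂.vec) e₃.form - interior e₃.vec (extD (e₁.form + e₂.form)) =
      (lieD e₁.vec e₃.form - interior e₃.vec (extD e₁.form)) +
      (lieD e₂.vec e₃.form - interior e₃.vec (extD e₂.form))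
    rw [lieD_add_left h₁.1 h₂.1 h₃.2, extD_add h₁.2 h₂.2, interior_add_right]
    abel
  bracket_add (e₁ : Sec E M k) h₁ (e₂ : Sec E M k) h₂ (e₃ : Sec E M k) h₃ := by
    refine Sec.ext (lie_add_right h₂.1 h₃.1) ?_
    change lieD e₁.vec (e₂.form + e₃.form) - interior (e₂.vec + e₃.vec) (extD e₁.form) =
      (lieD e₁.vec e₂.form - interior e₂.vec (extD e₁.form)) +
      (lieD e₁.vec e₃.form - interior e₃.vec (extD e₁.form))
    rw [lieD_add h₁.1 h₂.2 h₃.2, interior_add_left]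
    abel
  smul_bracket c (e₁ : Sec E M k) h₁ (e₂ : Sec E M k) h₂ := by
    refine Sec.ext (lie_const_smul_left c h₁.1) ?_
    change lieD (c • e₁.vec) e₂.form - interior e₂.vec (extD (c • e₁.form)) =
      c • (lieD e₁.vec e₂.form - interior e₂.vec (extD e₁.form))
    rw [lieD_const_smul_left c h₁.1 h₂.2, extD_const_smul c h₁.2, smul_sub]
    rfl
  bracket_smul c (e₁ : Sec E M k) h₁ (e₂ : Sec E M k) h₂ := by
    refine Sec.ext (lie_const_smul_right c h₂.1) ?_
    change lieD e₁.vec (c • e₂.form) - interior (c • e₂.vec) (extD e₁.form) =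
      c • (lieD e₁.vec e₂.form - interior e₂.vec (extD e₁.form))
    rw [lieD_const_smul c h₁.1 h₂.2, smul_sub]
    exact congrArg _ (interior_smul_left (fun _ => c) _ _)
  leibniz_identity _ h₁ _ h₂ _ h₃ := dorfman_leibniz h₁ h₂ h₃
  leibniz_rule (e₁ : Sec E M k) h₁ (e₂ : Sec E M k) h₂ f hf := by
    refine Sec.ext (lie_smul_right hf h₂.1) ?_
    change lieD e₁.vec (fun x => f x • e₂.form x) -
        interior (fun x => f x • e₂.vec x) (extD e₁.form) =
      fun x => f x • (lieD e₁.vec e₂.form - interior e₂.vec (extD e₁.form)) x +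
        dfun f x (e₁.vec x) • e₂.form x
    rw [lieD_smul hf h₁.1 h₂.2, interior_smul_left]
    funext x
    simp only [Pi.sub_apply, smul_sub]
    abel
  anchor_bracket _ _ _ _ := rfl

end

/-! ### The bracket twisted by a multivector field -/

variable [FiniteDimensional ℝ E]

theorem sharpF_add {m : ℕ} (π : MultiVec E M (m + 1)) (α β : DForm E M m) :
    sharpF π (α + β) = sharpF π α + sharpF π β := funext fun x => map_add (sharp (π x)) _ _

theorem sharpF_sub {m : ℕ} (π : MultiVec E M (m + 1)) (α β : DForm E M m) :
    sharpF π (α - β) = sharpF π α - sharpF π β := funext fun x => map_sub (sharp (π x)) _ _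

variable {k : ℕ} (π : MultiVec E M (k + 2))

/-- Cartan's formula merges the last two terms of `[α, β]_π`, which shows it as the form part of a
Dorfman bracket. -/
theorem formBracket_eq (α β : DForm E M (k + 1)) :
    formBracket π α β = lieD (sharpF π α) β - interior (sharpF π β) (extD α) := by
  rw [formBracket, lieD_eq_succ (sharpF π β)]
  abel

/-- The two mixed Lie brackets cancel by skew-symmetry; Cartan's formula turns `L_X α - i_X dα` into
`d i_X α`. -/
theorem twisted_self (X : VField E M) (α : DForm E M (k + 1)) :
    twisted π (.mk X α) (.mk X α) =
      .mk 0 (extD (pairing (.mk X 0) (.mk 0 α)))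
      + .mk 0 (extD (pairing (.mk (sharpF π α) 0) (.mk 0 α)))
      - .mk (sharpF π (extD (pairing (.mk X 0) (.mk 0 α)))) 0 := by
  have hp : ∀ Y : VField E M, pairing (.mk Y 0) (.mk 0 α) = interior Y α := fun Y => add_zero _
  rw [hp, hp]
  refine Sec.ext ?_ ?_
  · change lie X X + lie X (sharpF π α) + lie (sharpF π α) X
      - sharpF π (lieD X α) + sharpF π (interior X (extD α)) =
      0 + 0 - sharpF π (extD (interior X α))
    rw [lie_self, lie_swap (sharpF π α), lieD_eq_succ, sharpF_add]
    abel
  · change lieD X α - interior X (extD α) + formBracket π α α =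
      extD (interior X α) + extD (interior (sharpF π α) α) - 0
    rw [formBracket, lieD_eq_succ X]
    abel

theorem twistF_vec (e : Sec E M (k + 1)) : (twistF π e).vec = e.vec + sharpF π e.form := rfl

theorem twist_bijective (x : M) : Function.Bijective (twist π x) := by
  refine Function.bijective_iff_has_inverse.2 ⟨fun p => (p.1 - sharp (π x) p.2, p.2), ?_, ?_⟩
  · exact fun p => Prod.ext (add_sub_cancel_right p.1 (sharp (π x) p.2)) rfl
  · exact fun p => Prod.ext (sub_add_cancel p.1 (sharp (π x) p.2)) rfl

theorem twistF_injective : Function.Injective (twistF π : Sec E M (k + 1) → Sec E M (k + 1)) :=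
  fun _ _ h => funext fun x => (twist_bijective π x).1 (congrFun h x)

variable [IsManifold 𝓘(ℝ, E) ∞ M] {π}

theorem twistF_mem (hπ : SmoothMultiVec π) {e : Sec E M (k + 1)} :
    twistF π e ∈ smoothSec E M (k + 1) ↔ e ∈ smoothSec E M (k + 1) := by
  refine ⟨fun h => ⟨?_, h.2⟩, fun h => ⟨h.1.add (SmoothVField.sharpF hπ h.2), h.2⟩⟩
  have := h.1.sub (SmoothVField.sharpF (α := e.form) hπ h.2)
  rwa [twistF_vec, add_sub_cancel_right] at this

/-- `π^♯` maps the bracket of forms induced by `π` to the Lie bracket. -/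
def IsSharpMorphism (π : MultiVec E M (k + 2)) : Prop :=
  ∀ α β : DForm E M (k + 1), SmoothDForm α → SmoothDForm β →
    lie (sharpF π α) (sharpF π β) = sharpF π (formBracket π α β)

/-- In the vector part the only bracket absent from `twisted` is `[π^♯ α, π^♯ β]`, which `hm`
provides. The form part is additivity together with `formBracket_eq`. -/
theorem twistF_twisted (hπ : SmoothMultiVec π) (hm : IsSharpMorphism π) {e₁ e₂ : Sec E M (k + 1)}
    (h₁ : e₁ ∈ smoothSec E M (k + 1)) (h₂ : e₂ ∈ smoothSec E M (k + 1)) :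
    twistF π (twisted π e₁ e₂) = dorfman (twistF π e₁) (twistF π e₂) := by
  have s₁ := SmoothVField.sharpF hπ h₁.2
  have s₂ := SmoothVField.sharpF hπ h₂.2
  refine Sec.ext ?_ ?_
  · change lie e₁.vec e₂.vec + lie e₁.vec (sharpF π e₂.form) + lie (sharpF π e₁.form) e₂.vec
      - sharpF π (lieD e₁.vec e₂.form) + sharpF π (interior e₂.vec (extD e₁.form)) +
      sharpF π (lieD e₁.vec e₂.form - interior e₂.vec (extD e₁.form) +
        formBracket π e₁.form e₂.form) =
      lie (e₁.vec + sharpF π e₁.form) (e₂.vec + sharpF π e₂.form)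
    rw [lie_add_left h₁.1 s₁, lie_add_right h₂.1 s₂, lie_add_right h₂.1 s₂, hm _ _ h₁.2 h₂.2,
      sharpF_add, sharpF_sub]
    abel
  · change lieD e₁.vec e₂.form - interior e₂.vec (extD e₁.form) + formBracket π e₁.form e₂.form =
      lieD (e₁.vec + sharpF π e₁.form) e₂.form -
        interior (e₂.vec + sharpF π e₂.form) (extD e₁.form)
    rw [lieD_add_left h₁.1 s₁ h₂.2, interior_add_left, formBracket_eq]
    abel

/-- `Ψ` is injective and linear over functions and intertwines the brackets, so each identity may be
checked after applying it. The anchor is the vector part of `Ψ`. -/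
theorem isLeibnizAlgebroid_twisted (hπ : SmoothMultiVec π) (hm : IsSharpMorphism π) :
    IsLeibnizAlgebroid (smoothSec E M (k + 1)) (twisted π) (anchor π) := by
  have D := isLeibnizAlgebroid_dorfman (E := E) (M := M) (k := k + 1)
  have T : ∀ {e : Sec E M (k + 1)}, e ∈ smoothSec E M (k + 1) →
      twistF π e ∈ smoothSec E M (k + 1) := fun h => (twistF_mem hπ).2 h
  have B : ∀ {e₁ e₂ : Sec E M (k + 1)}, e₁ ∈ smoothSec E M (k + 1) → e₂ ∈ smoothSec E M (k + 1) →
      twistF π (twisted π e₁ e₂) = dorfman (twistF π e₁) (twistF π e₂) :=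
    fun h₁ h₂ => twistF_twisted hπ hm h₁ h₂
  have C : ∀ {e₁ e₂ : Sec E M (k + 1)}, e₁ ∈ smoothSec E M (k + 1) → e₂ ∈ smoothSec E M (k + 1) →
      twisted π e₁ e₂ ∈ smoothSec E M (k + 1) := fun {e₁ e₂} h₁ h₂ =>
    (twistF_mem hπ).1 (by rw [B h₁ h₂]; exact D.bracket_mem _ (T h₁) _ (T h₂))
  have A : ∀ e₁ e₂ : Sec E M (k + 1), twistF π (e₁ + e₂) = twistF π e₁ + twistF π e₂ :=
    fun e₁ e₂ => funext fun x => map_add (twist π x) _ _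
  have S : ∀ (f : M → ℝ) (e : Sec E M (k + 1)),
      twistF π (fun x => f x • e x) = fun x => f x • twistF π e x :=
    fun f e => funext fun x => map_smul (twist π x) _ _
  have S' : ∀ (c : ℝ) (e : Sec E M (k + 1)), twistF π (c • e) = c • twistF π e :=
    fun c e => S (fun _ => c) e
  exact
  { anchor_smooth := fun e h => (T h).1
    bracket_mem := fun e₁ h₁ e₂ h₂ => C h₁ h₂
    add_bracket := fun e₁ h₁ e₂ h₂ e₃ h₃ => twistF_injective π (by
      rw [B (smoothSec_add h₁ h₂) h₃, A, A, B h₁ h₃, B h₂ h₃]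
      exact D.add_bracket _ (T h₁) _ (T h₂) _ (T h₃))
    bracket_add := fun e₁ h₁ e₂ h₂ e₃ h₃ => twistF_injective π (by
      rw [B h₁ (smoothSec_add h₂ h₃), A, A, B h₁ h₂, B h₁ h₃]
      exact D.bracket_add _ (T h₁) _ (T h₂) _ (T h₃))
    smul_bracket := fun c e₁ h₁ e₂ h₂ => twistF_injective π (by
      rw [B (smoothSec_const_smul c h₁) h₂, S', S', B h₁ h₂]
      exact D.smul_bracket c _ (T h₁) _ (T h₂))
    bracket_smul := fun c e₁ h₁ e₂ h₂ => twistF_injective π (by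
      rw [B h₁ (smoothSec_const_smul c h₂), S', S', B h₁ h₂]
      exact D.bracket_smul c _ (T h₁) _ (T h₂))
    leibniz_identity := fun e₁ h₁ e₂ h₂ e₃ h₃ => twistF_injective π (by
      rw [A, B h₁ (C h₂ h₃), B h₂ h₃, B (C h₁ h₂) h₃, B h₁ h₂, B h₂ (C h₁ h₃), B h₁ h₃]
      exact D.leibniz_identity _ (T h₁) _ (T h₂) _ (T h₃))
    leibniz_rule := fun e₁ h₁ e₂ h₂ f hf => twistF_injective π (by
      rw [B h₁ (smoothSec_smul hf h₂), S]
      refine (D.leibniz_rule _ (T h₁) _ (T h₂) f hf).trans ?_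
      rw [← B h₁ h₂]
      funext x
      change _ = twist π x (f x • twisted π e₁ e₂ x + dfun f x (anchor π x (e₁ x)) • e₂ x)
      rw [map_add, map_smul, map_smul]
      rfl)
    anchor_bracket := fun e₁ h₁ e₂ h₂ => congrArg Sec.vec (B h₁ h₂) }

/-! ### The pairing -/

theorem lieD_pairing (hπ : SmoothMultiVec π) {X Y Z : VField E M} {α β γ : DForm E M (k + 1)}
    (hX : SmoothVField X) (hY : SmoothVField Y) (hZ : SmoothVField Z)
    (hα : SmoothDForm α) (hβ : SmoothDForm β) (hγ : SmoothDForm γ) :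
    lieD (fun x => anchor π x (X x, α x)) (pairing (.mk Y β) (.mk Z γ)) =
      pairing
        (twisted π (.mk X α) (.mk Y β)
          - .mk (lie X (sharpF π β) - sharpF π (lieD X β) + sharpF π (interior Y (extD α))) 0
          + .mk 0 (interior (sharpF π β) (extD α)))
        (.mk Z γ)
      + pairing (.mk Y β)
        (twisted π (.mk X α) (.mk Z γ)
          - .mk (lie X (sharpF π γ) - sharpF π (lieD X γ) + sharpF π (interior Z (extD α))) 0
          + .mk 0 (interior (sharpF π γ) (extD α))) := by
  have hs := SmoothVField.sharpF hπ hα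
  -- With `ρ = X + π^♯ α`, the corrected bracket with `W + δ` is `[ρ, W] + L_ρ δ - i_W dα`.
  have key : ∀ {W : VField E M} (δ : DForm E M (k + 1)), SmoothVField W → SmoothDForm δ →
      twisted π (.mk X α) (.mk W δ)
        - .mk (lie X (sharpF π δ) - sharpF π (lieD X δ) + sharpF π (interior W (extD α))) 0
        + .mk 0 (interior (sharpF π δ) (extD α)) =
      Sec.mk (lie (X + sharpF π α) W) (lieD (X + sharpF π α) δ - interior W (extD α)) := by
    intro W δ hW hδ
    refine Sec.ext ?_ ?_
    · change lie X W + lie X (sharpF π δ) + lie (sharpF π α) W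
        - sharpF π (lieD X δ) + sharpF π (interior W (extD α))
        - (lie X (sharpF π δ) - sharpF π (lieD X δ) + sharpF π (interior W (extD α))) + 0 =
        lie (X + sharpF π α) W
      rw [lie_add_left hX hs]
      abel
    · change lieD X δ - interior W (extD α) + formBracket π α δ - 0
        + interior (sharpF π δ) (extD α) = lieD (X + sharpF π α) δ - interior W (extD α)
      rw [lieD_add_left hX hs hδ, formBracket_eq]
      abel
  rw [key β hY hβ, key γ hZ hγ]
  change lieD (X + sharpF π α) (interior Y γ + interior Z β) =
    (interior (lie (X + sharpF π α) Y) γ +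
      interior Z (lieD (X + sharpF π α) β - interior Y (extD α))) +
    (interior Y (lieD (X + sharpF π α) γ - interior Z (extD α)) +
      interior (lie (X + sharpF π α) Z) β)
  have hX' := hX.add hs
  -- `L_ρ` commutes with contraction up to the Lie bracket; the leftover `i_Z i_Y dα` and `i_Y i_Z
  -- dα` cancel.
  rw [lieD_add hX' (hγ.interior hY) (hβ.interior hZ), lieD_interior hX' hY hγ,
    lieD_interior hX' hZ hβ, interior_sub_right, interior_sub_right, interior_interior Z Y]
  abel

end Brackets

section Nambu

open Set VectorField

variable {E : Type*} [NormedAddCommGroup E] [NormedSpace ℝ E]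

/-! ### The fundamental identity in a chart -/

/-- The fundamental identity for a multivector field on a normed space, at the point `y`. -/
def FundamentalIdentityAt {k : ℕ} (P : E → (E →L[ℝ] ℝ) [⋀^Fin (k + 2)]→L[ℝ] ℝ) (y : E) : Prop :=
  ∀ (u : Fin (k + 1) → E → ℝ) (g : Fin (k + 2) → E → ℝ),
    (∀ i, ContDiff ℝ ∞ (u i)) → (∀ i, ContDiff ℝ ∞ (g i)) →
    P y (Fin.snoc (α := fun _ => E →L[ℝ] ℝ) (fun i => fderiv ℝ (u i) y)
      (fderiv ℝ (fun z => P z (fun i => fderiv ℝ (g i) z)) y)) =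
      ∑ i, P y (Function.update (fun j => fderiv ℝ (g j) y) i
        (fderiv ℝ (fun z => P z (Fin.snoc (α := fun _ => E →L[ℝ] ℝ) (fun j => fderiv ℝ (u j) z)
          (fderiv ℝ (g i) z))) y))

theorem FundamentalIdentityAt.linear {k : ℕ} {P : E → (E →L[ℝ] ℝ) [⋀^Fin (k + 2)]→L[ℝ] ℝ} {y : E}
    (h : FundamentalIdentityAt P y) : LinearFundamentalIdentity P y := by
  intro ξ g
  have := h (fun i => ξ i) (fun i => g i) (fun i => (ξ i).contDiff) (fun i => (g i).contDiff)
  simpa only [ContinuousLinearMap.fderiv] using this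

/-- A function with zero differential and nonzero Hessian at `y` isolates the algebraic part of the
fundamental identity: every term containing a derivative of `P` vanishes at `y`. -/
theorem FundamentalIdentityAt.quadratic {k : ℕ}
    {P : E → (E →L[ℝ] ℝ) [⋀^Fin (k + 2)]→L[ℝ] ℝ} {y : E}
    (h : FundamentalIdentityAt P y) (hP : DifferentiableAt ℝ P y) :
    QuadraticIdentity (P y).toAlternatingMap 0 (Fin.last (k + 1)) := by
  intro u b g
  -- The first linear function is replaced by the product of `u 0` and `b`, both recentred to vanish
  -- at `y`.
  let U : Fin (k + 1) → E → ℝ :=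
    Function.update (fun i z => u i.castSucc z) 0 (fun z => u 0 (z - y) * b (z - y))
  have hU : ∀ i, ContDiff ℝ ∞ (U i) := by
    intro i
    rcases eq_or_ne i 0 with rfl | hi
    · simp only [U, Function.update_self]
      fun_prop
    · simp only [U, Function.update_of_ne hi]
      fun_prop
  have h0 : ∀ z, fderiv ℝ (U 0) z = u 0 (z - y) • b + b (z - y) • u 0 := by
    intro z
    simp only [U, Function.update_self]
    have h1 : ∀ c : E →L[ℝ] ℝ, HasFDerivAt (fun z => c (z - y)) c z := fun c => by
      simpa using hasFDerivAt_clm_comp (G := E) (H := ℝ) c ((hasFDerivAt_id z).sub_const y)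
    exact ((h1 (u 0)).mul (h1 b)).fderiv
  have hi : ∀ z, ∀ i ≠ 0, fderiv ℝ (U i) z = u i.castSucc := by
    intro z i hi
    simp only [U, Function.update_of_ne hi]
    exact ContinuousLinearMap.fderiv _
  have hsn : ∀ z c, (Fin.snoc (α := fun _ => E →L[ℝ] ℝ) (fun j => fderiv ℝ (U j) z) c) =
      Function.update (Function.update u (Fin.last (k + 1)) c) 0
        (u 0 (z - y) • b + b (z - y) • u 0) := by
    intro z c
    funext j
    refine Fin.lastCases ?_ (fun j => ?_) j
    · rw [Fin.snoc_last, Function.update_of_ne (by simp [Fin.ext_iff]), Function.update_self]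
    · rw [Fin.snoc_castSucc]
      rcases eq_or_ne j 0 with rfl | hj
      · rw [h0, Fin.castSucc_zero, Function.update_self]
      · rw [hi z j hj, Function.update_of_ne (Fin.castSucc_ne_zero_iff.2 hj),
          Function.update_of_ne (Fin.castSucc_lt_last j).ne]
  have hPz : ∀ z c, P z (Fin.snoc (α := fun _ => E →L[ℝ] ℝ) (fun j => fderiv ℝ (U j) z) c) =
      u 0 (z - y) * P z (Function.update (Function.update u (Fin.last (k + 1)) c) 0 b) +
        b (z - y) * P z (Function.update u (Fin.last (k + 1)) c) := by
    intro z c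
    have h2 : Function.update (Function.update u (Fin.last (k + 1)) c) 0 (u 0) =
        Function.update u (Fin.last (k + 1)) c := by
      rw [Function.update_comm (by simp [Fin.ext_iff]), Function.update_eq_self]
    rw [hsn, ContinuousAlternatingMap.map_update_add, ContinuousAlternatingMap.map_update_smul,
      ContinuousAlternatingMap.map_update_smul, h2]
    rfl
  have hd : ∀ c, fderiv ℝ (fun z => P z
      (Fin.snoc (α := fun _ => E →L[ℝ] ℝ) (fun j => fderiv ℝ (U j) z) c)) y =
      P y (Function.update (Function.update u (Fin.last (k + 1)) c) 0 b) • u 0 +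
        P y (Function.update u (Fin.last (k + 1)) c) • b := by
    intro c
    simp only [hPz]
    have h1 : ∀ c : E →L[ℝ] ℝ, HasFDerivAt (fun z => c (z - y)) c y := fun c => by
      simpa using hasFDerivAt_clm_comp (G := E) (H := ℝ) c ((hasFDerivAt_id y).sub_const y)
    have h2 : ∀ v, HasFDerivAt (fun z => P z v)
        ((ContinuousAlternatingMap.apply ℝ (E →L[ℝ] ℝ) ℝ v) ∘L fderiv ℝ P y) y := fun v =>
      hasFDerivAt_clm_comp (G := (E →L[ℝ] ℝ) [⋀^Fin (k + 2)]→L[ℝ] ℝ) (H := ℝ)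
        (ContinuousAlternatingMap.apply ℝ (E →L[ℝ] ℝ) ℝ v) hP.hasFDerivAt
    refine (((h1 (u 0)).mul (h2 _)).add ((h1 b).mul (h2 _))).fderiv.trans ?_
    simp
  have key := h U (fun i => g i) hU (fun i => (g i).contDiff)
  simp only [ContinuousLinearMap.fderiv] at key
  simp only [hd] at key
  rw [hPz, sub_self, map_zero, map_zero, zero_mul, zero_mul, add_zero] at key
  -- The left side of the fundamental identity vanishes because the differential of `U 0` is zero at
  -- `y`; the right side is the sum sought.
  change ∑ i, P y _ * P y _ + ∑ i, P y _ * P y _ = 0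
  rw [← Finset.sum_add_distrib, key]
  refine Finset.sum_congr rfl fun i _ => ?_
  have hc : Function.update (Function.update u (Fin.last (k + 1)) (g i)) 0 b =
      Function.update (Function.update u 0 b) (Fin.last (k + 1)) (g i) :=
    Function.update_comm (by simp [Fin.ext_iff]) _ _ _
  rw [ContinuousAlternatingMap.map_update_add, ContinuousAlternatingMap.map_update_smul,
    ContinuousAlternatingMap.map_update_smul, hc]
  simp only [smul_eq_mul]
  ring

theorem flatLie_congr {m : ℕ} {X Y : E → E} {α : E → E [⋀^Fin m]→L[ℝ] ℝ} {y : E}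
    (h : X =ᶠ[nhds y] Y) : flatLie X α y = flatLie Y α y := by
  rw [flatLie, flatLie, h.fderiv_eq, h.self_of_nhds]

/-! ### From the bracket of functions on the manifold to identities in charts -/

variable {M : Type*} [TopologicalSpace M] [ChartedSpace E M] [IsManifold 𝓘(ℝ, E) ∞ M]

theorem apply_dfun_eq_inChart {k : ℕ} (π : MultiVec E M k) (F : Fin k → C^∞⟮𝓘(ℝ, E), M; ℝ⟯)
    {x₀ : M} {y : E} (hy : y ∈ (extChartAt 𝓘(ℝ, E) x₀).target) :
    π ((extChartAt 𝓘(ℝ, E) x₀).symm y)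
        (fun i => dfun (F i) ((extChartAt 𝓘(ℝ, E) x₀).symm y)) =
      MultiVec.inChart x₀ π y
        (fun i => fderiv ℝ (fun z => F i ((extChartAt 𝓘(ℝ, E) x₀).symm z)) y) := by
  rw [MultiVec.inChart_apply]
  congr 1
  funext i
  rw [fderiv_comp_chart (F i).contMDiff hy]
  ext v
  exact congrArg (dfun (F i) _) (chartD_chartD' hy v).symm

variable [FiniteDimensional ℝ E]

/-- A smooth function on the model space agrees near a point, in a chart, with a smooth function
on the manifold. -/
theorem exists_smooth_extension [T2Space M] (x₀ : M) {G : Type*} [NormedAddCommGroup G]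
    [NormedSpace ℝ G] {u : E → G} (hu : ContDiff ℝ ∞ u) :
    ∃ f : C^∞⟮𝓘(ℝ, E), M; 𝓘(ℝ, G), G⟯, ∀ᶠ y in nhds (extChartAt 𝓘(ℝ, E) x₀ x₀),
      f ((extChartAt 𝓘(ℝ, E) x₀).symm y) = u y := by
  obtain ⟨χ⟩ : Nonempty (SmoothBumpFunction 𝓘(ℝ, E) x₀) := inferInstance
  have h1 : ContMDiffOn 𝓘(ℝ, E) 𝓘(ℝ, G) ∞ (fun x => u (extChartAt 𝓘(ℝ, E) x₀ x))
      (chartAt E x₀).source := hu.contMDiff.comp_contMDiffOn (contMDiffOn_extChartAt (x := x₀))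
  refine ⟨⟨fun x => χ x • u (extChartAt 𝓘(ℝ, E) x₀ x), χ.contMDiff_smul h1⟩, ?_⟩
  have hc : Filter.Tendsto (extChartAt 𝓘(ℝ, E) x₀).symm (nhds (extChartAt 𝓘(ℝ, E) x₀ x₀))
      (nhds x₀) := by
    have := continuousAt_extChartAt_symm (I := 𝓘(ℝ, E)) x₀
    rwa [ContinuousAt, extChartAt_to_inv] at this
  filter_upwards [hc.eventually χ.eventuallyEq_one, extChartAt_target_mem_nhds (I := 𝓘(ℝ, E)) x₀]
    with y hy hyt
  change χ _ • u _ = u y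
  rw [hy, (extChartAt 𝓘(ℝ, E) x₀).right_inv hyt]
  exact one_smul _ _

/-- Test functions on `E` are extended to `M` from a neighbourhood of `x₀`. This suffices because
both sides depend only on germs at the centre. -/
theorem IsNambuPoisson.fundamentalIdentityAt [T2Space M] {k : ℕ} {π : MultiVec E M (k + 2)}
    (hπ : IsNambuPoisson π) (x₀ : M) :
    FundamentalIdentityAt (MultiVec.inChart x₀ π) (extChartAt 𝓘(ℝ, E) x₀ x₀) := by
  obtain ⟨-, br, hbr, hval⟩ := hπ
  intro u g hu hg
  choose U hU using fun i => exists_smooth_extension x₀ (hu i)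
  choose G hG using fun i => exists_smooth_extension x₀ (hg i)
  set φ := extChartAt 𝓘(ℝ, E) x₀
  set y := φ x₀
  set P := MultiVec.inChart x₀ π
  have hy : y ∈ φ.target := mem_extChartAt_target x₀
  have hB : ∀ F : Fin (k + 2) → C^∞⟮𝓘(ℝ, E), M; ℝ⟯, ∀ z ∈ φ.target,
      br F (φ.symm z) = P z (fun i => fderiv ℝ (fun w => F i (φ.symm w)) z) :=
    fun F z hz => (hval F _).trans (apply_dfun_eq_inChart π F hz)
  have hD : ∀ {f : C^∞⟮𝓘(ℝ, E), M; ℝ⟯} {v : E → ℝ}, (∀ᶠ z in nhds y, f (φ.symm z) = v z) →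
      ∀ᶠ z in nhds y, fderiv ℝ (fun w => f (φ.symm w)) z = fderiv ℝ v z :=
    fun h => Filter.EventuallyEq.fderiv h
  -- The inner brackets must be known near `y`, not only at `y`, since the outer bracket
  -- differentiates them.
  have hBG : ∀ᶠ z in nhds y, br G (φ.symm z) = P z (fun i => fderiv ℝ (g i) z) := by
    filter_upwards [extChartAt_target_mem_nhds (I := 𝓘(ℝ, E)) x₀,
      Filter.eventually_all.2 fun i => hD (hG i)] with z hz h
    rw [hB G z hz]
    simp only [h]
  have hBU : ∀ i, ∀ᶠ z in nhds y,
      br (Fin.snoc (α := fun _ => C^∞⟮𝓘(ℝ, E), M; ℝ⟯) U (G i)) (φ.symm z) =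
        P z (Fin.snoc (α := fun _ => E →L[ℝ] ℝ) (fun j => fderiv ℝ (u j) z)
          (fderiv ℝ (g i) z)) := by
    intro i
    filter_upwards [extChartAt_target_mem_nhds (I := 𝓘(ℝ, E)) x₀,
      Filter.eventually_all.2 fun i => hD (hU i), hD (hG i)] with z hz h h'
    rw [hB _ z hz]
    congr 1
    funext j
    refine Fin.lastCases ?_ (fun j => ?_) j
    · simp only [Fin.snoc_last, h']
    · simp only [Fin.snoc_castSucc, h]
  have key := congrArg (fun f : C^∞⟮𝓘(ℝ, E), M; ℝ⟯ => f (φ.symm y)) (hbr.fundamental U G)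
  have hsum : ∀ (s : Finset (Fin (k + 2))) (F : Fin (k + 2) → C^∞⟮𝓘(ℝ, E), M; ℝ⟯) (x : M),
      (∑ i ∈ s, F i) x = ∑ i ∈ s, F i x := fun s F x =>
    map_sum (ContMDiffMap.evalRingHom x) F s
  simp only [hsum, hB _ y hy] at key
  convert key using 1
  · congr 1
    funext j
    refine Fin.lastCases ?_ (fun j => ?_) j
    · simp only [Fin.snoc_last]
      exact (hD hBG).self_of_nhds.symm
    · simp only [Fin.snoc_castSucc]
      exact (hD (hU j)).self_of_nhds.symm
  · refine Finset.sum_congr rfl fun i _ => congrArg (P y) (funext fun j => ?_)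
    rcases eq_or_ne j i with rfl | hj
    · simp only [Function.update_self]
      exact (hD (hBU j)).self_of_nhds.symm
    · simp only [Function.update_of_ne hj]
      exact (hD (hG j)).self_of_nhds.symm

theorem IsNambuPoisson.isSharpMorphism [T2Space M] {k : ℕ} {π : MultiVec E M (k + 2)}
    (hπ : IsNambuPoisson π) : IsSharpMorphism π := by
  intro α β hα hβ
  refine VField.ext_inChart fun x => ?_
  have hy := mem_extChartAt_target (I := 𝓘(ℝ, E)) x
  have hP := (hπ.1.contDiffAt hy).differentiableAt (by simp)
  have hF := hπ.fundamentalIdentityAt x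
  have hs : ∀ γ : DForm E M (k + 1), VField.inChart x (sharpF π γ) =ᶠ[nhds
      (extChartAt 𝓘(ℝ, E) x x)] fun z => sharp (MultiVec.inChart x π z) (DForm.inChart x γ z) := by
    intro γ
    filter_upwards [extChartAt_target_mem_nhds' hy] with z hz using inChart_sharpF hz π γ
  have hsα := SmoothVField.sharpF hπ.1 hα
  have hsub : DForm.inChart x (lieD (sharpF π α) β - interior (sharpF π β) (extD α))
      (extChartAt 𝓘(ℝ, E) x x) = DForm.inChart x (lieD (sharpF π α) β) (extChartAt 𝓘(ℝ, E) x x) -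
      DForm.inChart x (interior (sharpF π β) (extD α)) (extChartAt 𝓘(ℝ, E) x x) := rfl
  rw [inChart_lie hsα (SmoothVField.sharpF hπ.1 hβ) hy,
    (hs α).lieBracket_vectorField_eq (hs β),
    lieBracket_sharp hP (hα.differentiableAt hy) (hβ.differentiableAt hy) hF.linear
      (hF.quadratic hP),
    inChart_sharpF hy, formBracket_eq, hsub, inChart_lieD hsα hy hβ, inChart_interior hy,
    inChart_extD hα hy, flatLie_congr (hs α), (hs β).self_of_nhds]

end Nambu

/-! ### The twisted bracket is not skew-symmetric -/

section NonSkew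

theorem eq_zero_of_eq_neg {V : Type*} [AddCommGroup V] [Module ℝ V] {v : V} (h : v = -v) :
    v = 0 := by
  have h2 : v = (2⁻¹ : ℝ) • (v + v) := by module
  rw [h2, add_eq_zero_iff_eq_neg.2 h, smul_zero]

variable {E : Type*} [NormedAddCommGroup E] [NormedSpace ℝ E]
  {M : Type*} [TopologicalSpace M] [ChartedSpace E M] [IsManifold 𝓘(ℝ, E) ∞ M]

theorem dfun_eq_fderiv {f : M → ℝ} (hf : ContMDiff 𝓘(ℝ, E) 𝓘(ℝ, ℝ) ∞ f) (x : M) :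
    dfun f x = fderiv ℝ (fun y => f ((extChartAt 𝓘(ℝ, E) x).symm y)) (extChartAt 𝓘(ℝ, E) x x) := by
  have h : ∀ v, chartD x (extChartAt 𝓘(ℝ, E) x x) v = v := by
    intro v
    have := mfderivWithin_range_extChartAt_symm (I := 𝓘(ℝ, E)) (x := x)
    rw [modelWithCornersSelf_coe, Set.range_id, mfderivWithin_univ] at this
    exact congrArg (fun L => L v) this
  let D : M → E →L[ℝ] ℝ := fun x => dfun f x
  rw [fderiv_comp_chart hf (mem_extChartAt_target x)]
  ext v
  change D x v = D ((extChartAt 𝓘(ℝ, E) x).symm (extChartAt 𝓘(ℝ, E) x x))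
    (chartD x (extChartAt 𝓘(ℝ, E) x x) v)
  rw [extChartAt_to_inv]
  exact congrArg (D x) (h v).symm

theorem extD_zero {k : ℕ} : extD (0 : DForm E M k) = 0 := by
  simpa using extD_sub (SmoothDForm.zero (E := E) (M := M) (k := k)) SmoothDForm.zero

/-- Since `i_X i_X α = 0`, Cartan's formula leaves only `i_X d i_X α`. -/
theorem lieD_interior_self {k : ℕ} {X : VField E M} {α : DForm E M (k + 1)}
    (h : extD (interior X α) = 0) : lieD X (interior X α) = 0 := by
  cases k with
  | zero => exact congrArg (interior X) h
  | succ k =>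
    have h0 : interior X (interior X α) = 0 := eq_zero_of_eq_neg (interior_interior X X α)
    rw [lieD_eq_succ, h, h0, extD_zero, interior_zero_right, add_zero]

variable [FiniteDimensional ℝ E]

theorem smoothDForm_wedge {m : ℕ} (F : Fin m → C^∞⟮𝓘(ℝ, E), M; ℝ⟯) :
    SmoothDForm (E := E) (M := M) fun x => wedge fun i => dfun (F i) x := by
  intro x₀
  refine contDiffOn_form fun v => ?_
  have h : ∀ y ∈ (extChartAt 𝓘(ℝ, E) x₀).target,
      DForm.inChart x₀ (fun x => wedge fun i => dfun (F i) x) y v =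
        ∑ σ : Equiv.Perm (Fin m), ((Equiv.Perm.sign σ : ℤ) : ℝ) *
          ∏ i, fderiv ℝ (fun y => F (σ i) ((extChartAt 𝓘(ℝ, E) x₀).symm y)) y (v i) := by
    intro y hy
    rw [DForm.inChart_apply, wedge_apply, Matrix.det_apply']
    refine Finset.sum_congr rfl fun σ _ => congrArg _ (Finset.prod_congr rfl fun i _ => ?_)
    rw [fderiv_comp_chart (F (σ i)).contMDiff hy]
    rfl
  refine ContDiffOn.congr ?_ h
  refine ContDiffOn.sum fun σ _ => contDiffOn_const.mul (contDiffOn_prod fun i _ => ?_)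
  exact ((contDiffOn_comp_chart (F (σ i)).contMDiff x₀).fderiv_of_isOpen
    (isOpen_extChartAt_target x₀) (by simp)).clm_apply contDiffOn_const

theorem exists_smoothVField [T2Space M] (x : M) (v : TangentSpace 𝓘(ℝ, E) x) :
    ∃ X : VField E M, SmoothVField X ∧ X x = v := by
  obtain ⟨s, hs, hsm⟩ := FiberBundle.exists_contMDiffOn_extend (k := ∞) 𝓘(ℝ, E) E v
  obtain ⟨χ, -, hχ⟩ := (SmoothBumpFunction.nhds_basis_tsupport (I := 𝓘(ℝ, E)) x).mem_iff.1
    (interior_mem_nhds.2 hs)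
  refine ⟨fun y => χ y • FiberBundle.extend E v y, ContMDiffOn.smul_section_of_tsupport
    χ.contMDiff.contMDiffOn isOpen_interior hχ (hsm.mono interior_subset), ?_⟩
  change χ x • FiberBundle.extend E v x = v
  rw [χ.eq_one, one_smul, FiberBundle.extend_apply_self]

/-- If `d i_X α` always vanished, then so would `L_X (i_X α)` and, for `f α` in place of `α`, `L_X
(f i_X α)`. The Leibniz rule would give `X(f) i_X α = 0`, which fails for a suitable choice at one
point. -/
theorem exists_extD_interior_ne_zero [T2Space M] [Nonempty M] {k : ℕ}
    (hk : k + 1 ≤ Module.finrank ℝ E) :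
    ∃ (X : VField E M) (α : DForm E M (k + 1)), SmoothVField X ∧ SmoothDForm α ∧
      extD (interior X α) ≠ 0 := by
  by_contra! h
  obtain ⟨x⟩ := ‹Nonempty M›
  -- The dimension bound supplies `k + 1` basis vectors and their dual covectors. The functions `F
  -- i` have differential `ξ i` at `x`, so that `X(F 0) = 1` and the wedge of the differentials
  -- takes the value `1` on `v`.
  let v : Fin (k + 1) → E := fun i => bv E (Fin.castLE hk i)
  let ξ : Fin (k + 1) → (E →L[ℝ] ℝ) := fun i => bc E (Fin.castLE hk i)
  have hξ : ∀ i j, ξ i (v j) = (1 : Matrix (Fin (k + 1)) (Fin (k + 1)) ℝ) i j := by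
    intro i j
    simp [ξ, v, bc, bv, Matrix.one_apply, Finsupp.single_apply, eq_comm]
  choose F hF using fun i => exists_smooth_extension x (ξ i).contDiff
  have hd : ∀ i, dfun (F i) x = ξ i := by
    intro i
    rw [dfun_eq_fderiv (F i).contMDiff, Filter.EventuallyEq.fderiv_eq (hF i)]
    exact (ξ i).fderiv
  obtain ⟨X, hX, hXx⟩ := exists_smoothVField x (v 0)
  have hβ := smoothDForm_wedge F
  set β : DForm E M (k + 1) := fun x => wedge fun i => dfun (F i) x with hβ_def
  have e := lieD_smul (F 0).contMDiff hX (hβ.interior hX)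
  rw [lieD_interior_self (h X β hX hβ), ← interior_smul_right,
    lieD_interior_self (h X _ hX (hβ.smul (F 0).contMDiff))] at e
  have e1 := congrArg (fun A => A (fun i => v i.succ)) (congrFun e x)
  have e2 : (0 : ℝ) = F 0 x * 0 + ξ 0 (v 0) * wedge ξ v := by
    refine e1.trans ?_
    change F 0 x * 0 + dfun (F 0) x (X x) * wedge (fun i => dfun (F i) x)
      (Fin.cons (X x) fun i => v i.succ) = _
    simp only [hd, hXx]
    congr 3
    exact Fin.cons_self_tail v
  have h1 : (Matrix.of fun i j => ξ i (v j)) = 1 := by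
    ext i j
    exact hξ i j
  rw [wedge_apply, h1, Matrix.det_one, hξ, Matrix.one_apply_eq] at e2
  norm_num at e2

/-- Skew-symmetry makes the square of `Y + α` vanish for every `Y`. The form part at `Y = 0` shows
that the term containing `π^♯ α` is zero, whence `d i_X α = 0`. -/
theorem not_skew_twisted [T2Space M] [Nonempty M] {k : ℕ} (π : MultiVec E M (k + 2))
    (hk : k + 1 ≤ Module.finrank ℝ E) :
    ¬ ∀ e₁ ∈ smoothSec E M (k + 1), ∀ e₂ ∈ smoothSec E M (k + 1),
      twisted π e₁ e₂ = - twisted π e₂ e₁ := by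
  intro h
  obtain ⟨X, α, hX, hα, hne⟩ := exists_extD_interior_ne_zero (M := M) hk
  have key : ∀ Y : VField E M, SmoothVField Y →
      extD (interior Y α) + extD (interior (sharpF π α) α) = 0 := by
    intro Y hY
    have hs : Sec.mk Y α ∈ smoothSec E M (k + 1) := ⟨hY, hα⟩
    have h0 := eq_zero_of_eq_neg (h _ hs _ hs)
    rw [twisted_self] at h0
    have hp : ∀ Y : VField E M, pairing (.mk Y 0) (.mk 0 α) = interior Y α := fun Y => add_zero _
    rw [hp, hp] at h0
    exact (sub_zero _).symm.trans (congrArg Sec.form h0)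
  have hz : interior (0 : VField E M) α = 0 := by
    simpa using interior_add_left (0 : VField E M) 0 α
  have h0 := key 0 SmoothVField.zero
  rw [hz, extD_zero, zero_add] at h0
  have h1 := key X hX
  rw [h0, add_zero] at h1
  exact hne h1

end NonSkew

end NambuCourant

end

/-- Here `n = k + 2`, so that `π` is an `n`-vector field (a Nambu-Poisson structure of order
`n - 1 ≥ 1`), the sections are those of `TM ⊕ ∧^{n-1} T^*M`, and the pairing takes values in
`(n-2)`-forms. -/
theorem theorem6p1 {E : Type*} [NormedAddCommGroup E] [NormedSpace ℝ E] [FiniteDimensional ℝ E]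
    {M : Type*} [TopologicalSpace M] [T2Space M] [ChartedSpace E M] [IsManifold 𝓘(ℝ, E) ∞ M]
    (k : ℕ) (π : NambuCourant.MultiVec E M (k + 2)) (hπ : NambuCourant.IsNambuPoisson π) :
    -- the Leibniz algebroid
    NambuCourant.IsLeibnizAlgebroid (NambuCourant.smoothSec E M (k + 1))
      (NambuCourant.twisted π) (NambuCourant.anchor π) ∧
    -- conjugation to the higher Dorfman bracket by the invertible bundle map `Ψ`
    (∀ x : M, Function.Bijective (NambuCourant.twist π x)) ∧
    (∀ e : NambuCourant.Sec E M (k + 1),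
      NambuCourant.twistF π e ∈ NambuCourant.smoothSec E M (k + 1) ↔
        e ∈ NambuCourant.smoothSec E M (k + 1)) ∧
    (∀ e₁ ∈ NambuCourant.smoothSec E M (k + 1), ∀ e₂ ∈ NambuCourant.smoothSec E M (k + 1),
      NambuCourant.twistF π (NambuCourant.twisted π e₁ e₂) =
        NambuCourant.dorfman (NambuCourant.twistF π e₁) (NambuCourant.twistF π e₂)) ∧
    -- the bracket is not skew-symmetric (as soon as `M` carries nonzero `(n-1)`-forms)
    (Nonempty M → k + 1 ≤ Module.finrank ℝ E →
      ¬ ∀ e₁ ∈ NambuCourant.smoothSec E M (k + 1), ∀ e₂ ∈ NambuCourant.smoothSec E M (k + 1),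
        NambuCourant.twisted π e₁ e₂ = - NambuCourant.twisted π e₂ e₁) ∧
    -- the formula for `[[X + α, X + α]]_π`
    (∀ (X : NambuCourant.VField E M) (α : NambuCourant.DForm E M (k + 1)),
      NambuCourant.SmoothVField X → NambuCourant.SmoothDForm α →
      NambuCourant.twisted π (.mk X α) (.mk X α) =
        .mk 0 (NambuCourant.extD (NambuCourant.pairing (.mk X 0) (.mk 0 α)))
        + .mk 0 (NambuCourant.extD
            (NambuCourant.pairing (.mk (NambuCourant.sharpF π α) 0) (.mk 0 α)))
        - .mk (NambuCourant.sharpF π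
            (NambuCourant.extD (NambuCourant.pairing (.mk X 0) (.mk 0 α)))) 0) ∧
    -- compatibility with the pairing
    (∀ (X Y Z : NambuCourant.VField E M) (α β γ : NambuCourant.DForm E M (k + 1)),
      NambuCourant.SmoothVField X → NambuCourant.SmoothVField Y → NambuCourant.SmoothVField Z →
      NambuCourant.SmoothDForm α → NambuCourant.SmoothDForm β → NambuCourant.SmoothDForm γ →
      NambuCourant.lieD (fun x => NambuCourant.anchor π x (X x, α x))
          (NambuCourant.pairing (.mk Y β) (.mk Z γ)) =
        NambuCourant.pairing
          (NambuCourant.twisted π (.mk X α) (.mk Y β)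
            - .mk (NambuCourant.lie X (NambuCourant.sharpF π β)
                - NambuCourant.sharpF π (NambuCourant.lieD X β)
                + NambuCourant.sharpF π
                    (NambuCourant.interior Y (NambuCourant.extD α))) 0
            + .mk 0 (NambuCourant.interior (NambuCourant.sharpF π β) (NambuCourant.extD α)))
          (.mk Z γ)
        + NambuCourant.pairing (.mk Y β)
          (NambuCourant.twisted π (.mk X α) (.mk Z γ)
            - .mk (NambuCourant.lie X (NambuCourant.sharpF π γ)
                - NambuCourant.sharpF π (NambuCourant.lieD X γ)
                + NambuCourant.sharpF π
                    (NambuCourant.interior Z (NambuCourant.extD α))) 0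
            + .mk 0 (NambuCourant.interior (NambuCourant.sharpF π γ)
                (NambuCourant.extD α)))) := by
  have hm := hπ.isSharpMorphism
  exact ⟨NambuCourant.isLeibnizAlgebroid_twisted hπ.1 hm, NambuCourant.twist_bijective π,
    fun _ => NambuCourant.twistF_mem hπ.1,
    fun _ h₁ _ h₂ => NambuCourant.twistF_twisted hπ.1 hm h₁ h₂,
    fun _ hk => NambuCourant.not_skew_twisted π hk,
    fun X α _ _ => NambuCourant.twisted_self π X α,
    fun _ _ _ _ _ _ hX hY hZ hα hβ hγ => NambuCourant.lieD_pairing hπ.1 hX hY hZ hα hβ hγ⟩
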